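/- Let $S\subset[0,1]^2$ be the Sierpinski carpet, i.e. the set of all $x=(x_1,x_2)\in[0,1]^2$ such that for no $n\ge 1$ and $1\le k,l\le 3^{n-1}$ one has $\frac{3k-2}{3^n}<x_1<\frac{3k-1}{3^n}$ and $\frac{3l-2}{3^n}<x_2<\frac{3l-1}{3^n}$. Give $S$ the metric $d$ inherited from the Euclidean plane and the normalized Hausdorff measure $\mu=\mathcal H^s/\mathcal H^s(S)$, $s=\log 8/\log 3$. For measurable $A,B\subset S$ of positive measure let $\rho(A,B)$ be the supremum of $\inf_{x\in A',\,y\in B'}d(x,y)$ over all measurable $A',B'$ that differ from $A,B$ by null sets. For $f\in L^\infty(S,\mu)$ (real scalars) let $\rho_f(A,B)$ be the distance in $\mathbb R$ between the essential ranges of $f|_A$ and $f|_B$, let $L(f)=\sup\{\rho_f(A,B)/\rho(A,B) : \mu(A),\mu(B)>0,\ \rho(A,B)>0\}$, and let $\mathrm{Lip}(S)=\{f\in L^\infty(S,\mu): L(f)<\infty\}$, with norm $\max(L(f),\|f\|_\infty)$. Give $L^\infty(S,\mu)$ its weak* topology as the dual of $L^1(S,\mu)$. The space $\mathrm{Lip}(S)$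 is a dual Banach space, with the weak* topology that agrees on the unit ball with that of $L^\infty(S,\mu)$; its predual consists of the linear functionals on $\mathrm{Lip}(S)$ whose restriction to the unit ball is continuous for the weak* topology of $L^\infty(S,\mu)$. Let $\mathcal X(S)$ be the set of all metric derivations $\delta:\mathrm{Lip}(S)\to L^\infty(S,\mu)$, i.e. of all bounded, weak*-to-weak* continuous linear maps with $\delta(fg)=f\,\delta(g)+\delta(f)\,g$ for all $f,g\in\mathrm{Lip}(S)$. Then $\mathcal X(S)=\{0\}$. -/

import Mathlib

open MeasureTheory Set Filter Topology
open scoped ENNReal NNReal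

noncomputable section

namespace MetricMeasure

section Lipschitz

variable {M : Type*} [MeasurableSpace M]

/-- The essential range of the restriction of `f` to `A`. -/
def essRange (μ : Measure M) (f : M → ℝ) (A : Set M) : Set ℝ :=
  {a | ∀ U ∈ 𝓝 a, 0 < μ (A ∩ f ⁻¹' U)}

/-- The distance in `ℝ` between the essential ranges of `f` on `A` and on `B`. -/
def essRangeDist (μ : Measure M) (f : M → ℝ) (A B : Set M) : ℝ≥0∞ :=
  ⨅ a ∈ essRange μ f A, ⨅ b ∈ essRange μ f B, edist a b

theorem mem_essRange_iff {μ : Measure M} {f : M → ℝ} (hf : Measurable f) {A : Set M} (a : ℝ) :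
    a ∈ essRange μ f A ↔ a ∈ ((μ.restrict A).map f).support := by
  rw [Measure.mem_support_iff_forall]
  constructor
  · intro h U hU
    obtain ⟨V, hVU, hV, haV⟩ := mem_nhds_iff.1 hU
    refine lt_of_lt_of_le ?_ (measure_mono hVU)
    rw [Measure.map_apply hf hV.measurableSet, Measure.restrict_apply (hf hV.measurableSet),
      inter_comm]
    exact h V (hV.mem_nhds haV)
  · intro h U hU
    obtain ⟨V, hVU, hV, haV⟩ := mem_nhds_iff.1 hU
    have := h V (hV.mem_nhds haV)
    rw [Measure.map_apply hf hV.measurableSet, Measure.restrict_apply (hf hV.measurableSet),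
      inter_comm] at this
    exact this.trans_le (measure_mono (inter_subset_inter_right _ (preimage_mono hVU)))

/-- In a set `A`, almost every value of `f` is in the essential range of `f` on `A`. -/
theorem exists_subset_ae_eq {μ : Measure M} {f : M → ℝ} (hf : Measurable f) {A N : Set M}
    (hA : MeasurableSet A) (hN : μ Nᶜ = 0) :
    ∃ A' ⊆ A ∩ N, MeasurableSet A' ∧ A' =ᵐ[μ] A ∧ ∀ x ∈ A', f x ∈ essRange μ f A := by
  have h1 : ∀ᵐ x ∂(μ.restrict A), f x ∈ ((μ.restrict A).map f).support :=
    ae_of_ae_map hf.aemeasurable Measure.support_mem_ae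
  rw [ae_restrict_iff' hA] at h1
  have h2 : ∀ᵐ x ∂μ, x ∈ N := hN
  set A₀ : Set M := {x | x ∈ A ∧ x ∈ N ∧ f x ∈ essRange μ f A} with hA₀
  have h3 : A₀ =ᵐ[μ] A := by
    filter_upwards [h1, h2] with x hx1 hx2
    refine propext ⟨fun h => h.1, fun h => ⟨h, hx2, ?_⟩⟩
    exact (mem_essRange_iff hf _).2 (hx1 h)
  have h4 : NullMeasurableSet A₀ μ := hA.nullMeasurableSet.congr h3.symm
  obtain ⟨A', hs, hm, he⟩ := h4.exists_measurable_subset_ae_eq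
  exact ⟨A', fun x hx => ⟨(hs hx).1, (hs hx).2.1⟩, hm, he.trans h3, fun x hx => (hs hx).2.2⟩

variable [MetricSpace M]

/-- The measurable metric induced by the pointwise metric: the distance between two (positive
measure) sets is the supremum, over all measurable modifications of the two sets by null sets, of
the infimum of the pointwise distances. -/
def essDist (μ : Measure M) (A B : Set M) : ℝ≥0∞ :=
  ⨆ (A' : Set M) (_ : MeasurableSet A' ∧ A' =ᵐ[μ] A)
    (B' : Set M) (_ : MeasurableSet B' ∧ B' =ᵐ[μ] B),
    ⨅ x ∈ A', ⨅ y ∈ B', edist x y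

/-- The Lipschitz number of `f` with respect to the measurable metric: the supremum of the ratios
of distances, over pairs of positive measure sets that are at positive distance. -/
def lipNumber (μ : Measure M) (f : M → ℝ) : ℝ≥0∞ :=
  ⨆ (A : Set M) (B : Set M) (_ : MeasurableSet A ∧ 0 < μ A) (_ : MeasurableSet B ∧ 0 < μ B)
    (_ : 0 < essDist μ A B), essRangeDist μ f A B / essDist μ A B

theorem lipNumber_le_of_lipschitzOnWith {μ : Measure M} {f : M → ℝ} (hf : Measurable f)
    {K : ℝ≥0} {N : Set M} (hN : μ Nᶜ = 0) (hL : LipschitzOnWith K f N) :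
    lipNumber μ f ≤ K := by
  refine iSup_le fun A => iSup_le fun B => iSup_le fun hA => iSup_le fun hB => iSup_le fun _ => ?_
  apply ENNReal.div_le_of_le_mul
  obtain ⟨A', hAs, hAm, hAe, hAr⟩ := exists_subset_ae_eq hf hA.1 hN
  obtain ⟨B', hBs, hBm, hBe, hBr⟩ := exists_subset_ae_eq hf hB.1 hN
  have key : ∀ x ∈ A', ∀ y ∈ B', essRangeDist μ f A B ≤ K * edist x y := fun x hx y hy =>
    (iInf₂_le_of_le (f x) (hAr x hx) (iInf₂_le (f y) (hBr y hy))).trans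
      (hL (hAs hx).2 (hBs hy).2)
  have hd : (⨅ x ∈ A', ⨅ y ∈ B', edist x y) ≤ essDist μ A B :=
    le_iSup₂_of_le A' ⟨hAm, hAe⟩
      (le_iSup₂ (f := fun (B' : Set M) (_ : MeasurableSet B' ∧ B' =ᵐ[μ] B) =>
        ⨅ x ∈ A', ⨅ y ∈ B', edist x y) B' ⟨hBm, hBe⟩)
  rcases eq_or_ne K 0 with rfl | hK
  · have hA0 : A'.Nonempty := nonempty_of_measure_ne_zero (μ := μ)
      (by rw [measure_congr hAe]; exact hA.2.ne')
    have hB0 : B'.Nonempty := nonempty_of_measure_ne_zero (μ := μ)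
      (by rw [measure_congr hBe]; exact hB.2.ne')
    obtain ⟨x, hx⟩ := hA0
    obtain ⟨y, hy⟩ := hB0
    simpa using key x hx y hy
  · have hK' : (K : ℝ≥0∞) ≠ 0 := by exact_mod_cast hK
    have : essRangeDist μ f A B / K ≤ ⨅ x ∈ A', ⨅ y ∈ B', edist x y :=
      le_iInf₂ fun x hx => le_iInf₂ fun y hy => ENNReal.div_le_of_le_mul' (key x hx y hy)
    rw [mul_comm]
    exact (ENNReal.div_le_iff hK' ENNReal.coe_ne_top).1 (this.trans hd)

theorem exists_lipschitzOnWith_of_lipNumber_le [BorelSpace M] [SecondCountableTopology M]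
    {μ : Measure M} {f : M → ℝ} (hf : Measurable f) {K : ℝ≥0} (hK : lipNumber μ f ≤ K) :
    ∃ N : Set M, μ Nᶜ = 0 ∧ LipschitzOnWith K f N := by
  have hg : Measurable fun x => (x, f x) := measurable_id.prodMk hf
  set N : Set M := {x | (x, f x) ∈ (μ.map fun x => (x, f x)).support} with hNdef
  have hN : μ Nᶜ = 0 := ae_of_ae_map hg.aemeasurable Measure.support_mem_ae
  have hpos : ∀ x ∈ N, ∀ ε > 0, 0 < μ (Metric.ball x ε ∩ f ⁻¹' Metric.ball (f x) ε) := by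
    intro x hx ε hε
    have h := (Measure.mem_support_iff_forall _).1 hx (Metric.ball x ε ×ˢ Metric.ball (f x) ε)
      (prod_mem_nhds (Metric.ball_mem_nhds _ hε) (Metric.ball_mem_nhds _ hε))
    rwa [Measure.map_apply hg (Metric.isOpen_ball.measurableSet.prod
      Metric.isOpen_ball.measurableSet)] at h
  refine ⟨N, hN, LipschitzOnWith.of_dist_le_mul fun x hx y hy => ?_⟩
  rcases eq_or_ne x y with rfl | hxy
  · simp
  have hd : 0 < dist x y := dist_pos.2 hxy
  have main : ∀ ε > 0, 2 * ε < dist x y →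
      dist (f x) (f y) - 2 * ε ≤ K * (dist x y + 2 * ε) := by
    intro ε hε hεd
    set A := Metric.ball x ε ∩ f ⁻¹' Metric.ball (f x) ε with hA
    set B := Metric.ball y ε ∩ f ⁻¹' Metric.ball (f y) ε with hB
    have hAm : MeasurableSet A :=
      Metric.isOpen_ball.measurableSet.inter (hf Metric.isOpen_ball.measurableSet)
    have hBm : MeasurableSet B :=
      Metric.isOpen_ball.measurableSet.inter (hf Metric.isOpen_ball.measurableSet)
    have hAp : 0 < μ A := hpos x hx ε hε
    have hBp : 0 < μ B := hpos y hy ε hε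
    have hrange : ∀ z : M, ∀ a ∈ essRange μ f (Metric.ball z ε ∩ f ⁻¹' Metric.ball (f z) ε),
        dist a (f z) ≤ ε := by
      intro z a ha
      by_contra hcon
      have := ha (Metric.closedBall (f z) ε)ᶜ
        (Metric.isClosed_closedBall.isOpen_compl.mem_nhds (by simpa using hcon))
      have hempty : Metric.ball z ε ∩ f ⁻¹' Metric.ball (f z) ε ∩
          f ⁻¹' (Metric.closedBall (f z) ε)ᶜ = ∅ := by
        ext w
        simp only [mem_inter_iff, mem_preimage, Metric.mem_ball, mem_compl_iff,
          Metric.mem_closedBall, mem_empty_iff_false, iff_false, not_and, not_not]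
        exact fun h => h.2.le
      rw [hempty, measure_empty] at this
      exact lt_irrefl _ this
    have h1 : ENNReal.ofReal (dist (f x) (f y) - 2 * ε) ≤ essRangeDist μ f A B := by
      refine le_iInf₂ fun a ha => le_iInf₂ fun b hb => ?_
      rw [edist_dist]
      apply ENNReal.ofReal_le_ofReal
      have ha' := hrange x a ha
      have hb' := hrange y b hb
      have := dist_triangle4 (f x) a b (f y)
      rw [dist_comm (f x) a] at this
      linarith
    have h2 : essDist μ A B ≤ ENNReal.ofReal (dist x y + 2 * ε) := by
      refine iSup₂_le fun A' hA' => iSup₂_le fun B' hB' => ?_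
      have hne : ∀ {C C' : Set M}, C' =ᵐ[μ] C → 0 < μ C → (C' ∩ C).Nonempty := by
        intro C C' h h0
        apply nonempty_of_measure_ne_zero (μ := μ)
        have : (C' ∩ C : Set M) =ᵐ[μ] C := by
          simpa using h.inter (ae_eq_refl C)
        rw [measure_congr this]
        exact h0.ne'
      obtain ⟨u, hu', hu⟩ := hne hA'.2 hAp
      obtain ⟨v, hv', hv⟩ := hne hB'.2 hBp
      refine (iInf₂_le_of_le u hu' (iInf₂_le v hv')).trans ?_
      rw [edist_dist]
      apply ENNReal.ofReal_le_ofReal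
      have hu1 : dist u x < ε := hu.1
      have hv1 : dist v y < ε := hv.1
      have := dist_triangle4 u x y v
      rw [dist_comm y v] at this
      linarith
    have h3 : 0 < essDist μ A B := by
      have : ENNReal.ofReal (dist x y - 2 * ε) ≤ essDist μ A B := by
        refine le_iSup₂_of_le A ⟨hAm, ae_eq_refl A⟩ (le_iSup₂_of_le B ⟨hBm, ae_eq_refl B⟩ ?_)
        refine le_iInf₂ fun u hu => le_iInf₂ fun v hv => ?_
        rw [edist_dist]
        apply ENNReal.ofReal_le_ofReal
        have hu1 : dist u x < ε := hu.1
        have hv1 : dist v y < ε := hv.1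
        have := dist_triangle4 x u v y
        rw [dist_comm x u] at this
        linarith
      exact lt_of_lt_of_le (ENNReal.ofReal_pos.2 (by linarith)) this
    have h4 : essRangeDist μ f A B / essDist μ A B ≤ K := by
      refine le_trans ?_ hK
      exact le_iSup_of_le A (le_iSup_of_le B (le_iSup_of_le ⟨hAm, hAp⟩
        (le_iSup_of_le ⟨hBm, hBp⟩ (le_iSup_of_le h3 le_rfl))))
    have h5 : ENNReal.ofReal (dist (f x) (f y) - 2 * ε)
        ≤ ENNReal.ofReal (K * (dist x y + 2 * ε)) := by
      rw [ENNReal.ofReal_mul K.coe_nonneg, ENNReal.ofReal_coe_nnreal]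
      have h6 := (ENNReal.div_le_iff h3.ne' (ne_top_of_le_ne_top ENNReal.ofReal_ne_top h2)).1 h4
      exact h1.trans (h6.trans (mul_le_mul_right h2 _))
    exact (ENNReal.ofReal_le_ofReal_iff (by positivity)).1 h5
  have hlim1 : Tendsto (fun ε : ℝ => dist (f x) (f y) - 2 * ε) (𝓝[>] 0)
      (𝓝 (dist (f x) (f y) - 2 * 0)) :=
    (Continuous.tendsto (by fun_prop) _).mono_left nhdsWithin_le_nhds
  have hlim2 : Tendsto (fun ε : ℝ => K * (dist x y + 2 * ε)) (𝓝[>] 0)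
      (𝓝 (K * (dist x y + 2 * 0))) :=
    (Continuous.tendsto (by fun_prop) _).mono_left nhdsWithin_le_nhds
  have := le_of_tendsto_of_tendsto hlim1 hlim2 (by
    filter_upwards [Ioo_mem_nhdsGT (show (0 : ℝ) < dist x y / 2 by positivity)] with ε hε
    exact main ε hε.1 (by linarith [hε.2]))
  simpa using this

end Lipschitz

section Derivations

variable {M : Type*} [MetricSpace M] [MeasurableSpace M] [BorelSpace M]
  [SecondCountableTopology M]

theorem lipNumber_lt_top_iff {μ : Measure M} (f : Lp ℝ ∞ μ) :
    lipNumber μ f < ∞ ↔ ∃ (K : ℝ≥0) (N : Set M), μ Nᶜ = 0 ∧ LipschitzOnWith K f N := by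
  have hf : Measurable f := (Lp.stronglyMeasurable f).measurable
  constructor
  · intro h
    lift lipNumber μ f to ℝ≥0 using h.ne with K hK
    exact ⟨K, exists_lipschitzOnWith_of_lipNumber_le hf hK.ge⟩
  · rintro ⟨K, N, hN, hL⟩
    exact (lipNumber_le_of_lipschitzOnWith hf hN hL).trans_lt ENNReal.coe_lt_top

theorem lipNumber_lt_top_of_ae_eq {μ : Measure M} (f : Lp ℝ ∞ μ) {g : M → ℝ} (hg : f =ᵐ[μ] g)
    {K : ℝ≥0} {N : Set M} (hN : μ Nᶜ = 0) (hL : LipschitzOnWith K g N) : lipNumber μ f < ∞ := by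
  refine (lipNumber_lt_top_iff f).2 ⟨K, N ∩ {x | f x = g x}, ?_, ?_⟩
  · rw [compl_inter]
    exact measure_union_null hN hg
  · intro x hx y hy
    rw [hx.2, hy.2]
    exact hL hx.1 hy.1

/-- `Lip(M)`: the classes in `L^∞(M)` with finite Lipschitz number. -/
def Lip (μ : Measure M) : Submodule ℝ (Lp ℝ ∞ μ) where
  carrier := {f | lipNumber μ f < ∞}
  zero_mem' := lipNumber_lt_top_of_ae_eq 0 (Lp.coeFn_zero ℝ ∞ μ) (K := 0) (N := univ) (by simp)
    ((LipschitzWith.const (0 : ℝ)).lipschitzOnWith)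
  add_mem' := by
    intro f g hf hg
    obtain ⟨K, N, hN, hL⟩ := (lipNumber_lt_top_iff f).1 hf
    obtain ⟨K', N', hN', hL'⟩ := (lipNumber_lt_top_iff g).1 hg
    refine lipNumber_lt_top_of_ae_eq (f + g) (Lp.coeFn_add f g) (K := K + K') (N := N ∩ N') ?_
      ((hL.mono inter_subset_left).add (hL'.mono inter_subset_right))
    rw [compl_inter]
    exact measure_union_null hN hN'
  smul_mem' := by
    intro c f hf
    obtain ⟨K, N, hN, hL⟩ := (lipNumber_lt_top_iff f).1 hf
    exact lipNumber_lt_top_of_ae_eq (c • f) (Lp.coeFn_smul c f) hN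
      ((lipschitzWith_smul c).comp_lipschitzOnWith hL)

theorem lip_mul_mem {μ : Measure M} {f g : Lp ℝ ∞ μ} (hf : f ∈ Lip μ) (hg : g ∈ Lip μ) :
    (f • g : Lp ℝ ∞ μ) ∈ Lip μ := by
  obtain ⟨K, N, hN, hL⟩ := (lipNumber_lt_top_iff f).1 hf
  obtain ⟨K', N', hN', hL'⟩ := (lipNumber_lt_top_iff g).1 hg
  have hbound : ∀ h : Lp ℝ ∞ μ, ∃ C : ℝ≥0, ∀ᵐ x ∂μ, |h x| ≤ C := by
    intro h
    refine ⟨(eLpNormEssSup h μ).toNNReal, ?_⟩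
    have hfin : eLpNormEssSup h μ ≠ ∞ := by
      have := (Lp.memLp h).2.ne
      rwa [eLpNorm_exponent_top] at this
    filter_upwards [ae_le_eLpNormEssSup (f := h) (μ := μ)] with x hx
    rw [← ENNReal.coe_toNNReal hfin, enorm_eq_nnnorm] at hx
    exact_mod_cast hx
  obtain ⟨C, hC⟩ := hbound f
  obtain ⟨C', hC'⟩ := hbound g
  refine lipNumber_lt_top_of_ae_eq (f • g : Lp ℝ ∞ μ) (Lp.coeFn_lpSMul f g)
    (K := C * K' + C' * K) (N := N ∩ N' ∩ ({x | |f x| ≤ C} ∩ {x | |g x| ≤ C'})) ?_ ?_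
  · simp only [compl_inter]
    exact measure_union_null (measure_union_null hN hN') (measure_union_null hC hC')
  · refine LipschitzOnWith.of_dist_le_mul fun x hx y hy => ?_
    have h1 := hL.dist_le_mul x hx.1.1 y hy.1.1
    have h2 := hL'.dist_le_mul x hx.1.2 y hy.1.2
    have h3 : |f x| ≤ C := hx.2.1
    have h4 : |g y| ≤ C' := hy.2.2
    simp only [Pi.smul_apply', smul_eq_mul]
    rw [Real.dist_eq] at h1 h2 ⊢
    have h5 : f x * g x - f y * g y = f x * (g x - g y) + (f x - f y) * g y := by ring
    rw [h5]
    refine (abs_add_le _ _).trans ?_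
    rw [abs_mul, abs_mul]
    push_cast
    have h6 := mul_le_mul h3 h2 (abs_nonneg _) C.coe_nonneg
    have h7 := mul_le_mul h1 h4 (abs_nonneg _) (by positivity)
    nlinarith

/-- Pointwise (almost everywhere) multiplication of Lipschitz functions. -/
instance instMulLip (μ : Measure M) : Mul (Lip μ) :=
  ⟨fun f g => ⟨((f : Lp ℝ ∞ μ) • (g : Lp ℝ ∞ μ) : Lp ℝ ∞ μ), lip_mul_mem f.2 g.2⟩⟩

/-- The Lipschitz norm `max (L(f), ‖f‖_∞)`. -/
def lipNorm (μ : Measure M) (f : Lip μ) : ℝ :=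
  max (lipNumber μ (f : Lp ℝ ∞ μ)).toReal ‖(f : Lp ℝ ∞ μ)‖

/-- The weak* topology of `L^∞(M)` as the dual of `L^1(M)`. -/
@[reducible]
def linftyWeakStar (μ : Measure M) : TopologicalSpace (Lp ℝ ∞ μ) :=
  TopologicalSpace.induced (fun f (h : Lp ℝ 1 μ) => ∫ x, f x * h x ∂μ) inferInstance

/-- The canonical predual of `Lip(M)`: the linear functionals whose restriction to the closed unit
ball of `Lip(M)` is continuous for the weak* topology of `L^∞(M)`. -/
def lipPredual (μ : Measure M) : Set (Lip μ →ₗ[ℝ] ℝ) :=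
  {φ | @ContinuousOn (Lip μ) ℝ
    (TopologicalSpace.induced (fun f : Lip μ => (f : Lp ℝ ∞ μ)) (linftyWeakStar μ)) _
    φ {f | lipNorm μ f ≤ 1}}

/-- The weak* topology of `Lip(M)`: the topology of pointwise convergence on its predual. It is the
dual space topology that agrees, on the unit ball, with the weak* topology of `L^∞(M)`. -/
@[reducible]
def lipWeakStar (μ : Measure M) : TopologicalSpace (Lip μ) :=
  TopologicalSpace.induced (fun f (φ : lipPredual μ) => (φ : Lip μ →ₗ[ℝ] ℝ) f) inferInstance

/-- A metric derivation `Lip(M) → L^∞(M)`: a bounded, weak*-continuous linear map which satisfies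
the derivation identity. -/
structure IsMetricDerivation (μ : Measure M) (δ : Lip μ →ₗ[ℝ] Lp ℝ ∞ μ) : Prop where
  bounded : ∃ C : ℝ, ∀ f, ‖δ f‖ ≤ C * lipNorm μ f
  weakStar_continuous : @Continuous _ _ (lipWeakStar μ) (linftyWeakStar μ) δ
  leibniz : ∀ f g : Lip μ,
    δ (f * g) = ((f : Lp ℝ ∞ μ) • δ g : Lp ℝ ∞ μ) + ((g : Lp ℝ ∞ μ) • δ f : Lp ℝ ∞ μ)

/-- The measurable vector fields `𝒳(M)`: all metric derivations from `Lip(M)` to `L^∞(M)`. -/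
def vectorFields (μ : Measure M) : Set (Lip μ →ₗ[ℝ] Lp ℝ ∞ μ) :=
  {δ | IsMetricDerivation μ δ}

end Derivations

end MetricMeasure

/-- The Sierpinski carpet in the Euclidean plane. -/
def sierpinskiCarpet : Set (EuclideanSpace ℝ (Fin 2)) :=
  {x | (∀ i, x i ∈ Icc (0 : ℝ) 1) ∧
    ¬ ∃ n k l : ℕ, 1 ≤ n ∧ (1 ≤ k ∧ k ≤ 3 ^ (n - 1)) ∧ (1 ≤ l ∧ l ≤ 3 ^ (n - 1)) ∧
      ((3 * k - 2 : ℝ) / 3 ^ n < x 0 ∧ x 0 < (3 * k - 1 : ℝ) / 3 ^ n) ∧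
      ((3 * l - 2 : ℝ) / 3 ^ n < x 1 ∧ x 1 < (3 * l - 1 : ℝ) / 3 ^ n)}

/-- Normalized Hausdorff measure on the carpet, in its dimension `log 8 / log 3`; the carpet carries
the metric of the plane. -/
def carpetMeasure : Measure sierpinskiCarpet :=
  (Measure.hausdorffMeasure (Real.log 8 / Real.log 3) (univ : Set sierpinskiCarpet))⁻¹ •
    Measure.hausdorffMeasure (Real.log 8 / Real.log 3)

end

set_option linter.unusedSectionVars false

noncomputable section

/-! A metric derivation respects bounded pointwise convergence of uniformly Lipschitz functions,
which yields the `C¹` chain rule through polynomial approximation. For a closed Lebesgue null set `Z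
⊂ ℝ`, the identity of `ℝ` is a limit of `C¹` functions with derivatives in `[0,1]` that vanish on
`Z` and tend to `1` off `Z`. Passing to the limit in the chain rule gives `δ f = 0` on `F⁻¹(Z)`
(`ae_eq_zero_of_mem_closed_null`). By inner regularity `δ` kills every function whose distribution
is singular to Lebesgue measure.

Both coordinates of the carpet have singular distribution. The column masses are at most products of
the weights `3/8, 2/8, 3/8`, whereas column widths come from the weights `1/3, 1/3, 1/3`. The
Hellinger affinity of the two triples is below `1`, so the affinities at generation `n` decay
geometrically and Borel–Cantelli separates the two measures (`mutuallySingular_of_le_columnMass`).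

Killing the coordinates suffices. The kernel of `δ` contains constants and is stable under linear
combinations, absolute values, finite suprema and bounded limits; every Lipschitz function is a
supremum of countably many cones `F(p) - K ∑ |x_i - p_i|`
(`vectorFields_eq_zero_of_mutuallySingular`). -/

namespace MetricMeasure

/-! ### Bounded Lipschitz representatives and weak* convergence. -/

section General

variable {M : Type*} [MetricSpace M] [MeasurableSpace M] [BorelSpace M]
  [SecondCountableTopology M] {μ : Measure M}

/-- A `K`-Lipschitz function bounded by `C`. -/
structure IsBddLipschitz (K C : ℝ≥0) (F : M → ℝ) : Prop where
  lipschitz : LipschitzWith K F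
  bound : ∀ x, |F x| ≤ C

theorem IsBddLipschitz.memLp {K C : ℝ≥0} {F : M → ℝ} (hF : IsBddLipschitz K C F) :
    MemLp F ∞ μ :=
  memLp_top_of_bound hF.lipschitz.continuous.aestronglyMeasurable C
    (Eventually.of_forall hF.bound)

theorem IsBddLipschitz.exists_lip {K C : ℝ≥0} {F : M → ℝ} (hF : IsBddLipschitz K C F) :
    ∃ f : Lip μ, (f : Lp ℝ ∞ μ) =ᵐ[μ] F :=
  ⟨⟨hF.memLp.toLp F, lipNumber_lt_top_of_ae_eq _ hF.memLp.coeFn_toLp (N := univ) (by simp)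
    hF.lipschitz.lipschitzOnWith⟩, hF.memLp.coeFn_toLp⟩

theorem lipNumber_le {K : ℝ≥0} {F : M → ℝ} (hF : LipschitzWith K F)
    {f : Lip μ} (hf : (f : Lp ℝ ∞ μ) =ᵐ[μ] F) : lipNumber μ (f : Lp ℝ ∞ μ) ≤ K := by
  refine lipNumber_le_of_lipschitzOnWith (Lp.stronglyMeasurable (f : Lp ℝ ∞ μ)).measurable
    (N := {x | (f : Lp ℝ ∞ μ) x = F x}) hf fun x hx y hy => ?_
  rw [hx, hy]
  exact hF x y

theorem lipNorm_le [IsFiniteMeasure μ] {K C : ℝ≥0} {F : M → ℝ} (hF : IsBddLipschitz K C F)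
    {f : Lip μ} (hf : (f : Lp ℝ ∞ μ) =ᵐ[μ] F) : lipNorm μ f ≤ max K C := by
  refine max_le_max (ENNReal.toReal_le_coe_of_le_coe (lipNumber_le hF.lipschitz hf)) ?_
  have := Lp.norm_le_of_ae_bound (μ := μ) (p := ∞) (f := (f : Lp ℝ ∞ μ)) C.coe_nonneg
    (by filter_upwards [hf] with x hx; rw [hx]; exact hF.bound x)
  simpa using this

theorem ae_abs_le_norm (u : Lp ℝ ∞ μ) : ∀ᵐ x ∂μ, |u x| ≤ ‖u‖ := by
  have h := ae_le_eLpNormEssSup (f := u) (μ := μ)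
  filter_upwards [h] with x hx
  rw [Lp.norm_def, eLpNorm_exponent_top]
  have hfin : eLpNormEssSup u μ ≠ ∞ := by
    have := (Lp.memLp u).2.ne
    rwa [eLpNorm_exponent_top] at this
  rw [← ENNReal.ofReal_le_iff_le_toReal hfin]
  rwa [← Real.norm_eq_abs, ofReal_norm]

/-- McShane extension from a conull set, truncated at the essential supremum norm. It allows working
with everywhere defined functions. -/
theorem exists_isBddLipschitz (f : Lip μ) :
    ∃ (K C : ℝ≥0) (F : M → ℝ), IsBddLipschitz K C F ∧ (f : Lp ℝ ∞ μ) =ᵐ[μ] F := by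
  obtain ⟨K, N, hN, hL⟩ := (lipNumber_lt_top_iff (f : Lp ℝ ∞ μ)).1 f.2
  obtain ⟨g, hg, hgf⟩ := hL.extend_real
  set C : ℝ≥0 := ‖(f : Lp ℝ ∞ μ)‖₊
  refine ⟨K, C, fun x => max (-C) (min C (g x)), ⟨(hg.const_min _).const_max _, fun x => ?_⟩, ?_⟩
  · rw [abs_le]
    exact ⟨le_max_left _ _, max_le (by linarith [C.coe_nonneg]) (min_le_left _ _)⟩
  · have hN' : ∀ᵐ x ∂μ, x ∈ N := hN
    filter_upwards [hN', ae_abs_le_norm (f : Lp ℝ ∞ μ)] with x hx hb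
    have hb' : |g x| ≤ C := by rw [← hgf hx]; exact hb
    rw [abs_le] at hb'
    rw [hgf hx, min_eq_right hb'.2, max_eq_right hb'.1]

theorem lip_ext {f g : Lip μ} {F : M → ℝ} (hf : (f : Lp ℝ ∞ μ) =ᵐ[μ] F)
    (hg : (g : Lp ℝ ∞ μ) =ᵐ[μ] F) : f = g :=
  Subtype.ext (Lp.ext (hf.trans hg.symm))

theorem lip_mul_ae (f g : Lip μ) :
    ((f * g : Lip μ) : Lp ℝ ∞ μ) =ᵐ[μ] fun x => (f : Lp ℝ ∞ μ) x * (g : Lp ℝ ∞ μ) x :=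
  Lp.coeFn_lpSMul (r := ∞) (f : Lp ℝ ∞ μ) (g : Lp ℝ ∞ μ)

variable [IsFiniteMeasure μ]

/-- Dominated convergence against `L¹` gives weak* convergence in `L^∞`, which is what predual
functionals see on the unit ball. -/
theorem tendsto_predual {f : ℕ → Lip μ} {g : Lip μ} {F : ℕ → M → ℝ} {G : M → ℝ} {K C : ℝ≥0}
    (hF : ∀ n, IsBddLipschitz K C (F n)) (hG : IsBddLipschitz K C G)
    (hf : ∀ n, (f n : Lp ℝ ∞ μ) =ᵐ[μ] F n) (hg : (g : Lp ℝ ∞ μ) =ᵐ[μ] G)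
    (hlim : ∀ x, Tendsto (fun n => F n x) atTop (𝓝 (G x))) (φ : lipPredual μ) :
    Tendsto (fun n => (φ : Lip μ →ₗ[ℝ] ℝ) (f n)) atTop (𝓝 ((φ : Lip μ →ₗ[ℝ] ℝ) g)) := by
  -- Scaling by `c` moves the sequence and its limit into the unit ball, the only place where `φ` is
  -- known to be continuous; the `1` keeps `c` invertible.
  set c : ℝ≥0 := (max (max K C) 1)⁻¹ with hc
  have hc0 : 0 < c := by positivity
  have hcK : max (c * K) (c * C) ≤ 1 := by
    rw [← mul_max_of_nonneg _ _ zero_le, hc, inv_mul_le_iff₀ (by positivity), mul_one]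
    exact le_max_left _ _
  have scale : ∀ {H : M → ℝ} {h : Lip μ}, IsBddLipschitz K C H → (h : Lp ℝ ∞ μ) =ᵐ[μ] H →
      ((c : ℝ) • h : Lip μ) ∈ {f : Lip μ | lipNorm μ f ≤ 1} := by
    intro H h hH hh
    have hb : IsBddLipschitz (c * K) (c * C) (fun x => (c : ℝ) * H x) := by
      refine ⟨LipschitzWith.of_dist_le_mul fun x y => ?_, fun x => ?_⟩
      · have := hH.lipschitz.dist_le_mul x y
        rw [Real.dist_eq] at this ⊢
        rw [← mul_sub, abs_mul, abs_of_nonneg c.coe_nonneg]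
        push_cast
        rw [mul_assoc]
        gcongr
      · rw [abs_mul, abs_of_nonneg c.coe_nonneg]
        push_cast
        gcongr
        exact hH.bound x
    have he : (((c : ℝ) • h : Lip μ) : Lp ℝ ∞ μ) =ᵐ[μ] fun x => (c : ℝ) * H x := by
      have h0 : (((c : ℝ) • h : Lip μ) : Lp ℝ ∞ μ) = (c : ℝ) • (h : Lp ℝ ∞ μ) := rfl
      rw [h0]
      filter_upwards [Lp.coeFn_smul (c : ℝ) (h : Lp ℝ ∞ μ), hh] with x h1 h2
      rw [h1, Pi.smul_apply, h2, smul_eq_mul]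
    refine (lipNorm_le hb he).trans ?_
    exact_mod_cast hcK
  let τ : TopologicalSpace (Lip μ) :=
    TopologicalSpace.induced (fun f : Lip μ => (f : Lp ℝ ∞ μ)) (linftyWeakStar μ)
  have hcont : ContinuousOn (φ : Lip μ →ₗ[ℝ] ℝ) {f : Lip μ | lipNorm μ f ≤ 1} := φ.2
  have ht : Tendsto (fun n => ((c : ℝ) • f n : Lip μ)) atTop (𝓝 ((c : ℝ) • g : Lip μ)) := by
    rw [@nhds_induced _ _ (linftyWeakStar μ), tendsto_comap_iff, nhds_induced, tendsto_comap_iff,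
      tendsto_pi_nhds]
    intro h
    have hsm : ∀ k : Lip μ, ∫ x, (((c : ℝ) • k : Lip μ) : Lp ℝ ∞ μ) x * h x ∂μ
        = ∫ x, c * (k : Lp ℝ ∞ μ) x * h x ∂μ := by
      intro k
      refine integral_congr_ae ?_
      have h0 : (((c : ℝ) • k : Lip μ) : Lp ℝ ∞ μ) = (c : ℝ) • (k : Lp ℝ ∞ μ) := rfl
      rw [h0]
      filter_upwards [Lp.coeFn_smul (c : ℝ) (k : Lp ℝ ∞ μ)] with x h1
      rw [h1, Pi.smul_apply, smul_eq_mul]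
    simp only [Function.comp_def, hsm]
    refine tendsto_integral_of_dominated_convergence (fun x => c * C * ‖h x‖) ?_ ?_ ?_ ?_
    · exact fun n => ((Lp.aestronglyMeasurable _).const_mul _).mul (Lp.aestronglyMeasurable _)
    · exact (L1.integrable_coeFn h).norm.const_mul _
    · intro n
      filter_upwards [hf n] with x hx
      rw [norm_mul, norm_mul, hx, Real.norm_eq_abs, abs_of_nonneg c.coe_nonneg, Real.norm_eq_abs]
      gcongr
      exact (hF n).bound x
    · filter_upwards [ae_all_iff.2 hf, hg] with x h1 h2
      simp only [h1, h2]
      exact ((hlim x).const_mul _).mul_const _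
  have hw : Tendsto (fun n => ((c : ℝ) • f n : Lip μ)) atTop
      (𝓝[{f : Lip μ | lipNorm μ f ≤ 1}] ((c : ℝ) • g : Lip μ)) :=
    tendsto_nhdsWithin_iff.2 ⟨ht, Eventually.of_forall fun n => scale (hF n) (hf n)⟩
  have h1 := (hcont _ (scale hG hg)).tendsto.comp hw
  simp only [Function.comp_def, map_smul, smul_eq_mul] at h1
  have h2 := h1.const_mul (c : ℝ)⁻¹
  have hne : (c : ℝ) ≠ 0 := by exact_mod_cast hc0.ne'
  simpa [inv_mul_cancel_left₀ hne] using h2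

variable {δ : Lip μ →ₗ[ℝ] Lp ℝ ∞ μ}

/-! ### Closedness of derivations and the polynomial chain rule. -/

namespace IsMetricDerivation

/-- A metric derivation is closed under bounded pointwise convergence. -/
theorem ae_eq_of_tendsto (hδ : IsMetricDerivation μ δ) {f : ℕ → Lip μ} {g : Lip μ}
    {F : ℕ → M → ℝ} {G u : M → ℝ} {K C : ℝ≥0}
    (hF : ∀ n, IsBddLipschitz K C (F n)) (hG : IsBddLipschitz K C G)
    (hf : ∀ n, (f n : Lp ℝ ∞ μ) =ᵐ[μ] F n) (hg : (g : Lp ℝ ∞ μ) =ᵐ[μ] G)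
    (hlim : ∀ x, Tendsto (fun n => F n x) atTop (𝓝 (G x)))
    (hu : ∀ᵐ x ∂μ, Tendsto (fun n => δ (f n) x) atTop (𝓝 (u x))) : δ g =ᵐ[μ] u := by
  obtain ⟨D, hD⟩ := hδ.bounded
  set B : ℝ := |D| * max K C
  have hB : ∀ n, ‖δ (f n)‖ ≤ B := fun n =>
    (hD _).trans (mul_le_mul (le_abs_self D) (lipNorm_le (hF n) (hf n))
      (le_max_of_le_right (norm_nonneg _)) (abs_nonneg _))
  have hBae : ∀ᵐ x ∂μ, ∀ n, |δ (f n) x| ≤ B := by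
    rw [ae_all_iff]
    intro n
    filter_upwards [ae_abs_le_norm (δ (f n))] with x hx using hx.trans (hB n)
  have hum : AEStronglyMeasurable u μ :=
    aestronglyMeasurable_of_tendsto_ae atTop (fun n => Lp.aestronglyMeasurable (δ (f n))) hu
  have huB : ∀ᵐ x ∂μ, |u x| ≤ B := by
    filter_upwards [hBae, hu] with x h1 h2
    exact le_of_tendsto h2.abs (Eventually.of_forall h1)
  have hmem : MemLp (fun x => δ g x - u x) ∞ μ :=
    (Lp.memLp (δ g)).sub (memLp_top_of_bound hum B huB)
  have hmem1 : MemLp (fun x => δ g x - u x) 1 μ := hmem.mono_exponent le_top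
  have hui : MemLp u 1 μ := (memLp_top_of_bound hum B huB).mono_exponent le_top
  -- The test function is `δ g - u` itself, bounded and hence integrable: both `δ g` and `u` are
  -- limits of `δ (f n)` against it, so `∫ (δ g - u)² = 0`.
  set h : Lp ℝ 1 μ := hmem1.toLp _
  have hh : h =ᵐ[μ] fun x => δ g x - u x := hmem1.coeFn_toLp
  have hcont : @Continuous _ _ (lipWeakStar μ) (linftyWeakStar μ) δ := hδ.weakStar_continuous
  have ht : @Tendsto _ _ f atTop (@nhds _ (lipWeakStar μ) g) := by
    rw [nhds_induced, tendsto_comap_iff, tendsto_pi_nhds]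
    exact fun φ => tendsto_predual hF hG hf hg hlim φ
  have h1 : @Tendsto _ _ (fun n => δ (f n)) atTop (@nhds _ (linftyWeakStar μ) (δ g)) :=
    (@Continuous.tendsto _ _ (lipWeakStar μ) (linftyWeakStar μ) _ hcont g).comp ht
  rw [nhds_induced, tendsto_comap_iff, tendsto_pi_nhds] at h1
  have h2 := h1 h
  simp only [Function.comp_def] at h2
  have h3 : Tendsto (fun n => ∫ x, δ (f n) x * h x ∂μ) atTop (𝓝 (∫ x, u x * h x ∂μ)) := by
    refine tendsto_integral_of_dominated_convergence (fun x => B * ‖h x‖) ?_ ?_ ?_ ?_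
    · exact fun n => (Lp.aestronglyMeasurable _).mul (Lp.aestronglyMeasurable _)
    · exact (L1.integrable_coeFn h).norm.const_mul _
    · intro n
      filter_upwards [hBae] with x hx
      rw [norm_mul]
      gcongr
      exact hx n
    · filter_upwards [hu] with x hx using hx.mul_const _
  have h4 := tendsto_nhds_unique h2 h3
  have hint : ∀ {v : M → ℝ}, MemLp v ∞ μ → Integrable (fun x => v x * h x) μ := fun hv =>
    (L1.integrable_coeFn h).mul_of_top_right hv
  have h5 : ∫ x, (δ g x - u x) ^ 2 ∂μ = 0 := by
    rw [← sub_eq_zero, ← integral_sub (hint (Lp.memLp _)) (hint (memLp_top_of_bound hum B huB))]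
      at h4
    rw [← h4]
    refine integral_congr_ae ?_
    filter_upwards [hh] with x hx
    rw [hx]
    ring
  have h6 : Integrable (fun x => (δ g x - u x) ^ 2) μ := by
    refine (hint hmem).congr ?_
    filter_upwards [hh] with x hx
    rw [hx]
    ring
  rw [integral_eq_zero_iff_of_nonneg (fun x => sq_nonneg _) h6] at h5
  filter_upwards [h5] with x hx
  have : (δ g x - u x) ^ 2 = 0 := hx
  exact sub_eq_zero.1 (pow_eq_zero_iff two_ne_zero |>.1 this)

theorem leibniz_ae (hδ : IsMetricDerivation μ δ) (f g : Lip μ) :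
    δ (f * g) =ᵐ[μ] fun x => (f : Lp ℝ ∞ μ) x * δ g x + (g : Lp ℝ ∞ μ) x * δ f x := by
  rw [hδ.leibniz f g]
  filter_upwards [Lp.coeFn_add ((f : Lp ℝ ∞ μ) • δ g : Lp ℝ ∞ μ)
    ((g : Lp ℝ ∞ μ) • δ f : Lp ℝ ∞ μ), Lp.coeFn_lpSMul (r := ∞) (f : Lp ℝ ∞ μ) (δ g),
    Lp.coeFn_lpSMul (r := ∞) (g : Lp ℝ ∞ μ) (δ f)] with x h1 h2 h3
  rw [h1, Pi.add_apply, h2, h3]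
  rfl

/-- The unit `e` is idempotent, so the Leibniz rule reads `δ e = 2 δ e`. -/
theorem const (hδ : IsMetricDerivation μ δ) (c : ℝ) :
    ∃ g : Lip μ, (g : Lp ℝ ∞ μ) =ᵐ[μ] (fun _ => c) ∧ δ g = 0 := by
  have h1 : IsBddLipschitz 0 1 (fun _ : M => (1 : ℝ)) := ⟨LipschitzWith.const _, by simp⟩
  obtain ⟨e, he⟩ := h1.exists_lip (μ := μ)
  have hee : e * e = e := by
    refine lip_ext (F := fun _ => 1) ?_ he
    filter_upwards [lip_mul_ae e e, he] with x h1 h2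
    rw [h1, h2, one_mul]
  have h0 : δ e = 0 := by
    have h2 := hδ.leibniz_ae e e
    rw [hee] at h2
    apply Lp.ext
    filter_upwards [h2, he, Lp.coeFn_zero ℝ ∞ μ] with x h3 h4 h5
    rw [h5, Pi.zero_apply]
    rw [h4] at h3
    linarith
  refine ⟨c • e, ?_, by rw [map_smul, h0, smul_zero]⟩
  have h2 : ((c • e : Lip μ) : Lp ℝ ∞ μ) = c • (e : Lp ℝ ∞ μ) := rfl
  rw [h2]
  filter_upwards [Lp.coeFn_smul c (e : Lp ℝ ∞ μ), he] with x h3 h4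
  rw [h3, Pi.smul_apply, h4, smul_eq_mul, mul_one]

theorem polynomial (hδ : IsMetricDerivation μ δ) {f : Lip μ} {F : M → ℝ}
    (hf : (f : Lp ℝ ∞ μ) =ᵐ[μ] F) (p : Polynomial ℝ) :
    ∃ g : Lip μ, (g : Lp ℝ ∞ μ) =ᵐ[μ] (fun x => p.eval (F x)) ∧
      δ g =ᵐ[μ] fun x => p.derivative.eval (F x) * δ f x := by
  induction p using Polynomial.induction_on with
  | C a =>
    obtain ⟨g, hg, hg0⟩ := hδ.const a
    refine ⟨g, by simpa using hg, ?_⟩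
    rw [hg0]
    filter_upwards [Lp.coeFn_zero ℝ ∞ μ] with x hx
    rw [hx, Polynomial.derivative_C, Polynomial.eval_zero, zero_mul, Pi.zero_apply]
  | add p q hp hq =>
    obtain ⟨g, hg, hg'⟩ := hp
    obtain ⟨k, hk, hk'⟩ := hq
    refine ⟨g + k, ?_, ?_⟩
    · have h0 : ((g + k : Lip μ) : Lp ℝ ∞ μ) = (g : Lp ℝ ∞ μ) + (k : Lp ℝ ∞ μ) := rfl
      rw [h0]
      filter_upwards [Lp.coeFn_add (g : Lp ℝ ∞ μ) (k : Lp ℝ ∞ μ), hg, hk] with x h1 h2 h3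
      rw [h1, Pi.add_apply, h2, h3, Polynomial.eval_add]
    · rw [map_add]
      filter_upwards [Lp.coeFn_add (δ g) (δ k), hg', hk'] with x h1 h2 h3
      rw [h1, Pi.add_apply, h2, h3, Polynomial.derivative_add, Polynomial.eval_add, add_mul]
  | monomial n a hp =>
    obtain ⟨g, hg, hg'⟩ := hp
    have hpow : (Polynomial.C a * Polynomial.X ^ (n + 1) : Polynomial ℝ)
        = Polynomial.X * (Polynomial.C a * Polynomial.X ^ n) := by ring
    refine ⟨f * g, ?_, ?_⟩
    · filter_upwards [lip_mul_ae f g, hf, hg] with x h1 h2 h3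
      rw [h1, h2, h3, hpow, Polynomial.eval_mul (p := Polynomial.X), Polynomial.eval_X]
    · filter_upwards [hδ.leibniz_ae f g, hf, hg, hg'] with x h1 h2 h3 h4
      rw [h1, h2, h3, h4, hpow, Polynomial.derivative_mul (f := Polynomial.X),
        Polynomial.derivative_X, one_mul, Polynomial.eval_add,
        Polynomial.eval_mul (p := Polynomial.X), Polynomial.eval_X]
      ring

end IsMetricDerivation

end General

theorem exists_polynomial_derivative_eq (q : Polynomial ℝ) (a : ℝ) :
    ∃ p : Polynomial ℝ, p.derivative = q ∧ p.eval 0 = a := by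
  suffices h : ∃ p : Polynomial ℝ, p.derivative = q by
    obtain ⟨p, hp⟩ := h
    exact ⟨p + Polynomial.C (a - p.eval 0), by simp [hp], by simp⟩
  induction q using Polynomial.induction_on' with
  | add p q hp hq =>
    obtain ⟨P, rfl⟩ := hp
    obtain ⟨Q, rfl⟩ := hq
    exact ⟨P + Q, Polynomial.derivative_add⟩
  | monomial n b =>
    refine ⟨Polynomial.monomial (n + 1) (b / (n + 1)), ?_⟩
    rw [Polynomial.derivative_monomial]
    have : (n + 1 : ℝ) ≠ 0 := by positivity
    simp [this]

/-! ### The `C¹` chain rule and functions with singular distribution. -/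

section General

variable {M : Type*} [MetricSpace M] [MeasurableSpace M] [BorelSpace M]
  [SecondCountableTopology M] {μ : Measure M}

theorem IsBddLipschitz.comp {K C W : ℝ≥0} {F : M → ℝ} (hF : IsBddLipschitz K C F) {φ w : ℝ → ℝ}
    (hφ : ∀ t, HasDerivAt φ (w t) t) (hW : ∀ t ∈ Icc (-(C : ℝ)) C, |w t| ≤ W) :
    IsBddLipschitz (W * K) (‖φ 0‖₊ + W * C) (fun x => φ (F x)) := by
  have hmem : ∀ x, F x ∈ Icc (-(C : ℝ)) C := fun x => abs_le.1 (hF.bound x)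
  have key : ∀ {s t : ℝ}, s ∈ Icc (-(C : ℝ)) C → t ∈ Icc (-(C : ℝ)) C →
      ‖φ t - φ s‖ ≤ W * ‖t - s‖ := fun hs ht =>
    Convex.norm_image_sub_le_of_norm_hasDerivWithin_le (fun t _ => (hφ t).hasDerivWithinAt)
      hW (convex_Icc _ _) hs ht
  refine ⟨LipschitzWith.of_dist_le_mul fun x y => ?_, fun x => ?_⟩
  · rw [Real.dist_eq]
    refine (key (hmem y) (hmem x)).trans ?_
    push_cast
    rw [mul_assoc]
    exact mul_le_mul_of_nonneg_left (hF.lipschitz.dist_le_mul x y) W.coe_nonneg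
  · have h1 := key (s := 0) (by simp) (hmem x)
    rw [sub_zero, Real.norm_eq_abs, Real.norm_eq_abs] at h1
    have h2 := abs_sub_abs_le_abs_sub (φ (F x)) (φ 0)
    have h3 : (W : ℝ) * |F x| ≤ W * C := by
      gcongr
      exact hF.bound x
    push_cast
    rw [Real.norm_eq_abs]
    linarith

variable [IsFiniteMeasure μ] {δ : Lip μ →ₗ[ℝ] Lp ℝ ∞ μ}

namespace IsMetricDerivation

/-- The chain rule for continuously differentiable functions. -/
theorem comp (hδ : IsMetricDerivation μ δ) {f : Lip μ} {F : M → ℝ} {K C W : ℝ≥0}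
    (hF : IsBddLipschitz K C F) (hf : (f : Lp ℝ ∞ μ) =ᵐ[μ] F) {φ w : ℝ → ℝ}
    (hφ : ∀ t, HasDerivAt φ (w t) t) (hw : Continuous w)
    (hW : ∀ t ∈ Icc (-(C : ℝ)) C, |w t| ≤ W) :
    ∃ g : Lip μ, (g : Lp ℝ ∞ μ) =ᵐ[μ] (fun x => φ (F x)) ∧
      δ g =ᵐ[μ] fun x => w (F x) * δ f x := by
  have hmem : ∀ x, F x ∈ Icc (-(C : ℝ)) C := fun x => abs_le.1 (hF.bound x)
  -- Weierstrass is applied to the derivative `w`, and the approximant is integrated from the value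
  -- `φ 0`; the mean value inequality then controls `p n - φ` as well.
  have hq : ∀ n : ℕ, ∃ p : Polynomial ℝ, p.eval 0 = φ 0 ∧
      ∀ t ∈ Icc (-(C : ℝ)) C, |p.derivative.eval t - w t| ≤ 1 / (n + 1) := by
    intro n
    obtain ⟨q, hq⟩ := exists_polynomial_near_of_continuousOn (-(C : ℝ)) C w hw.continuousOn
      (1 / (n + 1)) (by positivity)
    obtain ⟨p, rfl, hp⟩ := exists_polynomial_derivative_eq q (φ 0)
    exact ⟨p, hp, fun t ht => (hq t ht).le⟩
  choose p hp0 hp using hq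
  have hone : ∀ n : ℕ, (1 : ℝ) / (n + 1) ≤ 1 := fun n => by
    rw [div_le_one (by positivity)]
    linarith [n.cast_nonneg (α := ℝ)]
  -- The extra `1` absorbs the approximation error, giving constants independent of `n`.
  have hpW : ∀ n, ∀ t ∈ Icc (-(C : ℝ)) C, |(p n).derivative.eval t| ≤ ((W + 1 : ℝ≥0) : ℝ) := by
    intro n t ht
    have h1 := abs_sub_abs_le_abs_sub ((p n).derivative.eval t) (w t)
    push_cast
    linarith [hp n t ht, hW t ht, hone n]
  have hP : ∀ n, IsBddLipschitz ((W + 1) * K) (‖φ 0‖₊ + (W + 1) * C)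
      (fun x => (p n).eval (F x)) := fun n => by
    have := hF.comp (fun t => (p n).hasDerivAt t) (hpW n)
    rwa [hp0 n] at this
  have hΦ : IsBddLipschitz ((W + 1) * K) (‖φ 0‖₊ + (W + 1) * C) (fun x => φ (F x)) :=
    hF.comp hφ fun t ht => (hW t ht).trans (by push_cast; linarith)
  choose g hg hg' using fun n => hδ.polynomial hf (p n)
  obtain ⟨k, hk⟩ := hΦ.exists_lip (μ := μ)
  have hlim0 : Tendsto (fun n : ℕ => (1 : ℝ) / (n + 1)) atTop (𝓝 0) :=
    tendsto_one_div_add_atTop_nhds_zero_nat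
  refine ⟨k, hk, hδ.ae_eq_of_tendsto hP hΦ hg hk (fun x => ?_) ?_⟩
  · rw [tendsto_iff_norm_sub_tendsto_zero]
    refine squeeze_zero (fun _ => norm_nonneg _) (fun n => ?_)
      (by simpa using hlim0.mul_const ‖F x‖)
    have := Convex.norm_image_sub_le_of_norm_hasDerivWithin_le
      (f := fun t => (p n).eval t - φ t)
      (fun t _ => (((p n).hasDerivAt t).sub (hφ t)).hasDerivWithinAt)
      (hp n) (convex_Icc _ _) (x := 0) (by simp) (hmem x)
    simpa [hp0 n] using this
  · filter_upwards [ae_all_iff.2 hg'] with x hx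
    simp only [hx]
    refine Tendsto.mul_const _ ?_
    rw [tendsto_iff_norm_sub_tendsto_zero]
    exact squeeze_zero (fun _ => norm_nonneg _) (fun n => hp n _ (hmem x)) hlim0

/-- A derivation of `f` vanishes on the preimage of a closed Lebesgue null set. -/
theorem ae_eq_zero_of_mem_closed_null (hδ : IsMetricDerivation μ δ) {f : Lip μ} {F : M → ℝ}
    {K C : ℝ≥0} (hF : IsBddLipschitz K C F) (hf : (f : Lp ℝ ∞ μ) =ᵐ[μ] F) {Z : Set ℝ}
    (hZ : IsClosed Z) (hZ0 : volume Z = 0) : ∀ᵐ x ∂μ, F x ∈ Z → δ f x = 0 := by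
  have hpos : ∀ n : ℕ, (0 : ℝ) < 1 / (n + 1) := fun n => by positivity
  -- Continuous, zero on `Z`, and tending to `1` off `Z` because `Z` is closed.
  set w : ℕ → ℝ → ℝ := fun n t => 1 - (thickenedIndicator (hpos n) Z t : ℝ) with hwdef
  have hw : ∀ n, Continuous (w n) := fun n =>
    continuous_const.sub (NNReal.continuous_coe.comp (thickenedIndicator (hpos n) Z).continuous)
  have hw1 : ∀ n t, |w n t| ≤ ((1 : ℝ≥0) : ℝ) := by
    intro n t
    have h1 : ((thickenedIndicator (hpos n) Z t : ℝ≥0) : ℝ) ≤ 1 := by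
      exact_mod_cast thickenedIndicator_le_one (hpos n) Z t
    have h0 : (0 : ℝ) ≤ (thickenedIndicator (hpos n) Z t : ℝ≥0) := NNReal.coe_nonneg _
    rw [abs_le, NNReal.coe_one]
    constructor <;> simp only [hwdef] <;> linarith
  have hwlim : ∀ t, Tendsto (fun n => w n t) atTop (𝓝 (Zᶜ.indicator (fun _ => (1 : ℝ)) t)) := by
    intro t
    have h := tendsto_pi_nhds.1 (thickenedIndicator_tendsto_indicator_closure hpos
      tendsto_one_div_add_atTop_nhds_zero_nat Z) t
    rw [hZ.closure_eq] at h
    have h2 := ((NNReal.continuous_coe.tendsto _).comp h).const_sub (1 : ℝ)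
    have h3 : Zᶜ.indicator (fun _ => (1 : ℝ)) t
        = 1 - ((Z.indicator (fun _ => (1 : ℝ≥0)) t : ℝ≥0) : ℝ) := by
      by_cases ht : t ∈ Z <;> simp [ht]
    rw [h3]
    exact h2
  set φ : ℕ → ℝ → ℝ := fun n t => ∫ s in (0 : ℝ)..t, w n s
  have hφ : ∀ n t, HasDerivAt (φ n) (w n t) t := fun n t =>
    intervalIntegral.integral_hasDerivAt_right ((hw n).intervalIntegrable _ _)
      ((hw n).stronglyMeasurableAtFilter _ _) (hw n).continuousAt
  have hφlim : ∀ t, Tendsto (fun n => φ n t) atTop (𝓝 t) := by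
    intro t
    have h1 : Tendsto (fun n => φ n t) atTop (𝓝 (∫ s in (0 : ℝ)..t, (1 : ℝ))) := by
      refine intervalIntegral.tendsto_integral_filter_of_dominated_convergence (fun _ => 1)
        (Eventually.of_forall fun n => (hw n).aestronglyMeasurable)
        (Eventually.of_forall fun n => Eventually.of_forall fun s _ => by simpa using hw1 n s)
        intervalIntegrable_const ?_
      -- Nullity of `Z` enters here: the primitives of `w n` lose no length in the limit.
      have : ∀ᵐ s : ℝ, s ∉ Z := measure_eq_zero_iff_ae_notMem.1 hZ0
      filter_upwards [this] with s hs _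
      simpa [hs] using hwlim s
    simpa using h1
  have hΦ : ∀ n, IsBddLipschitz (1 * K) (1 * C) (fun x => φ n (F x)) := fun n => by
    have := hF.comp (hφ n) fun t _ => hw1 n t
    simpa [φ] using this
  choose g hg hg' using fun n => hδ.comp hF hf (hφ n) (hw n) fun t _ => hw1 n t
  have key := hδ.ae_eq_of_tendsto hΦ (by simpa using hF) hg hf (fun x => hφlim (F x))
    (u := fun x => Zᶜ.indicator (fun _ => (1 : ℝ)) (F x) * δ f x) (by
      filter_upwards [ae_all_iff.2 hg'] with x hx
      simp only [hx]
      exact (hwlim _).mul_const _)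
  filter_upwards [key] with x hx hxZ
  rw [hx]
  simp [hxZ]

/-- A derivation kills every function whose distribution is singular. -/
theorem eq_zero_of_mutuallySingular (hδ : IsMetricDerivation μ δ) {f : Lip μ} {F : M → ℝ}
    {K C : ℝ≥0} (hF : IsBddLipschitz K C F) (hf : (f : Lp ℝ ∞ μ) =ᵐ[μ] F)
    (hs : (μ.map F) ⟂ₘ volume) : δ f = 0 := by
  obtain ⟨s, hsm, hs0, hs1⟩ := hs
  have hFm : Measurable F := hF.lipschitz.continuous.measurable
  have hδm : Measurable (δ f) := (Lp.stronglyMeasurable (δ f)).measurable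
  set A : Set M := {x | δ f x ≠ 0} with hA
  have hAm : MeasurableSet A := (hδm (measurableSet_singleton 0)).compl
  have hA0 : μ A = 0 := by
    by_contra hne
    have h1 : ((μ.restrict A).map F) sᶜ = μ A := by
      rw [Measure.map_apply hFm hsm.compl, Measure.restrict_apply (hFm hsm.compl)]
      rw [Measure.map_apply hFm hsm] at hs0
      refine measure_congr ?_
      have : ∀ᵐ x ∂μ, x ∉ F ⁻¹' s := measure_eq_zero_iff_ae_notMem.1 hs0
      filter_upwards [this] with x hx
      exact propext ⟨fun h => h.2, fun h => ⟨hx, h⟩⟩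
    -- The image of `μ` restricted to `A` is carried by the Lebesgue null set `sᶜ`. A compact piece
    -- `Z` of positive mass is closed and null, so `δ f` vanishes on `F⁻¹(Z)`, contradicting the
    -- definition of `A`.
    obtain ⟨Z, hZs, hZ, hZpos⟩ := hsm.compl.exists_lt_isCompact_of_ne_top
      (μ := (μ.restrict A).map F) (measure_ne_top _ _) (r := 0)
      (by rw [h1]; exact pos_iff_ne_zero.2 hne)
    have hnull := hδ.ae_eq_zero_of_mem_closed_null hF hf hZ.isClosed (measure_mono_null hZs hs1)
    rw [Measure.map_apply hFm hZ.measurableSet, Measure.restrict_apply (hFm hZ.measurableSet)]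
      at hZpos
    refine hZpos.ne' (measure_eq_zero_iff_ae_notMem.2 ?_)
    filter_upwards [hnull] with x hx hx'
    exact hx'.2 (hx hx'.1)
  apply Lp.ext
  filter_upwards [measure_eq_zero_iff_ae_notMem.1 hA0, Lp.coeFn_zero ℝ ∞ μ] with x hx hx0
  rw [hx0]
  simpa [hA] using hx

/-- The absolute value is the limit of the smooth 1-Lipschitz functions `√(t² + 1/(n+1))`, to each
of which the chain rule applies. -/
theorem abs_eq_zero (hδ : IsMetricDerivation μ δ) {f : Lip μ} {F : M → ℝ}
    {K C : ℝ≥0} (hF : IsBddLipschitz K C F) (hf : (f : Lp ℝ ∞ μ) =ᵐ[μ] F) (h0 : δ f = 0) :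
    ∃ g : Lip μ, (g : Lp ℝ ∞ μ) =ᵐ[μ] (fun x => |F x|) ∧ δ g = 0 := by
  have hpos : ∀ n : ℕ, (0 : ℝ) < 1 / (n + 1) := fun n => by positivity
  set φ : ℕ → ℝ → ℝ := fun n t => √(t ^ 2 + 1 / (n + 1))
  set w : ℕ → ℝ → ℝ := fun n t => t / √(t ^ 2 + 1 / (n + 1))
  have hp : ∀ (n : ℕ) (t : ℝ), 0 < t ^ 2 + 1 / ((n : ℝ) + 1) := fun n t => by positivity
  have hφ : ∀ n t, HasDerivAt (φ n) (w n t) t := by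
    intro n t
    have h1 : HasDerivAt (fun t : ℝ => t ^ 2 + 1 / ((n : ℝ) + 1)) (2 * t) t := by
      simpa using (hasDerivAt_pow 2 t).add_const (1 / ((n : ℝ) + 1))
    convert h1.sqrt (hp n t).ne' using 1
    exact (mul_div_mul_left _ _ two_ne_zero).symm
  have hw : ∀ n, Continuous (w n) := fun n =>
    continuous_id.div (by fun_prop) fun t => (Real.sqrt_pos.2 (hp n t)).ne'
  have hw1 : ∀ n t, |w n t| ≤ ((1 : ℝ≥0) : ℝ) := by
    intro n t
    rw [abs_div, abs_of_pos (Real.sqrt_pos.2 (hp n t)), div_le_iff₀ (Real.sqrt_pos.2 (hp n t)),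
      NNReal.coe_one, one_mul]
    exact Real.abs_le_sqrt (by linarith [hpos n])
  have hφ0 : ∀ n, ‖φ n 0‖₊ ≤ 1 := by
    intro n
    rw [← NNReal.coe_le_coe, coe_nnnorm, NNReal.coe_one, Real.norm_eq_abs,
      abs_of_nonneg (Real.sqrt_nonneg _), Real.sqrt_le_one]
    have : (1 : ℝ) / (n + 1) ≤ 1 := by
      rw [div_le_one (by positivity)]
      linarith [n.cast_nonneg (α := ℝ)]
    simpa using this
  have hΦ : ∀ n, IsBddLipschitz (1 * K) (1 + 1 * C) (fun x => φ n (F x)) := fun n => by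
    have := hF.comp (hφ n) fun t _ => hw1 n t
    refine ⟨this.lipschitz, fun x => (this.bound x).trans ?_⟩
    exact_mod_cast add_le_add_left (hφ0 n) _
  have hG : IsBddLipschitz (1 * K) (1 + 1 * C) (fun x => |F x|) := by
    refine ⟨?_, fun x => ?_⟩
    · have h1 : LipschitzWith 1 fun t : ℝ => |t| := by
        exact lipschitzWith_one_norm (E := ℝ)
      exact h1.comp hF.lipschitz
    · rw [abs_abs]
      push_cast
      linarith [hF.bound x]
  choose g hg hg' using fun n => hδ.comp hF hf (hφ n) (hw n) fun t _ => hw1 n t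
  obtain ⟨k, hk⟩ := hG.exists_lip (μ := μ)
  refine ⟨k, hk, Lp.ext ?_⟩
  refine (hδ.ae_eq_of_tendsto hΦ hG hg hk (fun x => ?_) (u := fun _ => 0) ?_).trans
    (Lp.coeFn_zero ℝ ∞ μ).symm
  · have h1 : Tendsto (fun n : ℕ => F x ^ 2 + 1 / ((n : ℝ) + 1)) atTop (𝓝 (F x ^ 2 + 0)) :=
      tendsto_const_nhds.add tendsto_one_div_add_atTop_nhds_zero_nat
    rw [← Real.sqrt_sq_eq_abs]
    simpa [φ] using h1.sqrt
  · rw [h0] at hg'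
    filter_upwards [ae_all_iff.2 hg', Lp.coeFn_zero ℝ ∞ μ] with x hx hx0
    simp only [hx, hx0, Pi.zero_apply, mul_zero]
    exact tendsto_const_nhds

end IsMetricDerivation

end General

/-! ### Lattice operations on the kernel of a derivation. -/

section Annihilator

variable {M : Type*} [MetricSpace M] [MeasurableSpace M] [BorelSpace M]
  [SecondCountableTopology M] {μ : Measure M}

/-- The class of `F` lies in `Lip(M)` and is killed by `δ`. -/
def Annihilates (δ : Lip μ →ₗ[ℝ] Lp ℝ ∞ μ) (F : M → ℝ) : Prop :=
  ∃ f : Lip μ, (f : Lp ℝ ∞ μ) =ᵐ[μ] F ∧ δ f = 0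

variable {δ : Lip μ →ₗ[ℝ] Lp ℝ ∞ μ}

namespace Annihilates

theorem add {F G : M → ℝ} (hF : Annihilates δ F) (hG : Annihilates δ G) :
    Annihilates δ (fun x => F x + G x) := by
  obtain ⟨f, hf, hf0⟩ := hF
  obtain ⟨g, hg, hg0⟩ := hG
  refine ⟨f + g, ?_, by rw [map_add, hf0, hg0, add_zero]⟩
  have h0 : ((f + g : Lip μ) : Lp ℝ ∞ μ) = (f : Lp ℝ ∞ μ) + (g : Lp ℝ ∞ μ) := rfl
  rw [h0]
  filter_upwards [Lp.coeFn_add (f : Lp ℝ ∞ μ) (g : Lp ℝ ∞ μ), hf, hg] with x h1 h2 h3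
  rw [h1, Pi.add_apply, h2, h3]

theorem const_mul {F : M → ℝ} (hF : Annihilates δ F) (c : ℝ) :
    Annihilates δ (fun x => c * F x) := by
  obtain ⟨f, hf, hf0⟩ := hF
  refine ⟨c • f, ?_, by rw [map_smul, hf0, smul_zero]⟩
  have h0 : ((c • f : Lip μ) : Lp ℝ ∞ μ) = c • (f : Lp ℝ ∞ μ) := rfl
  rw [h0]
  filter_upwards [Lp.coeFn_smul c (f : Lp ℝ ∞ μ), hf] with x h1 h2
  rw [h1, Pi.smul_apply, h2, smul_eq_mul]

theorem sub {F G : M → ℝ} (hF : Annihilates δ F) (hG : Annihilates δ G) :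
    Annihilates δ (fun x => F x - G x) := by
  simpa [sub_eq_add_neg] using hF.add (hG.const_mul (-1))

variable [IsFiniteMeasure μ]

theorem const (hδ : IsMetricDerivation μ δ) (c : ℝ) : Annihilates δ (fun _ => c) :=
  hδ.const c

theorem sum (hδ : IsMetricDerivation μ δ) {ι : Type*} (s : Finset ι) {F : ι → M → ℝ}
    (hF : ∀ i ∈ s, Annihilates δ (F i)) : Annihilates δ (fun x => ∑ i ∈ s, F i x) := by
  classical
  induction s using Finset.induction_on with
  | empty => simpa using const hδ 0
  | insert a s ha ih =>
    simp only [Finset.sum_insert ha]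
    exact (hF a (Finset.mem_insert_self _ _)).add
      (ih fun i hi => hF i (Finset.mem_insert_of_mem hi))

theorem abs (hδ : IsMetricDerivation μ δ) {F : M → ℝ} (hF : Annihilates δ F) :
    Annihilates δ (fun x => |F x|) := by
  obtain ⟨f, hf, hf0⟩ := hF
  obtain ⟨K, C, G, hG, hfG⟩ := exists_isBddLipschitz f
  obtain ⟨g, hg, hg0⟩ := hδ.abs_eq_zero hG hfG hf0
  refine ⟨g, ?_, hg0⟩
  filter_upwards [hf, hfG, hg] with x h1 h2 h3
  rw [h3, ← h2, h1]

/-- From `max(a, b) = (a + b + |a - b|) / 2`. -/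
theorem sup (hδ : IsMetricDerivation μ δ) {F G : M → ℝ} (hF : Annihilates δ F)
    (hG : Annihilates δ G) : Annihilates δ (F ⊔ G) := by
  have h := ((hF.add hG).add ((hF.sub hG).abs hδ)).const_mul (1 / 2)
  convert h using 1
  ext x
  rw [Pi.sup_apply, max_def]
  split_ifs with h1
  · rw [abs_of_nonpos (sub_nonpos.2 h1)]; ring
  · rw [abs_of_pos (sub_pos.2 (not_le.1 h1))]; ring

end Annihilates

end Annihilator

/-! ### Reduction to the coordinate functions. -/

section Euclidean

variable {ι : Type*} [Fintype ι]

theorem dist_le_sum_abs (x y : EuclideanSpace ℝ ι) : dist x y ≤ ∑ i, |x i - y i| := by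
  rw [EuclideanSpace.dist_eq]
  refine Real.sqrt_le_iff.2 ⟨by positivity, ?_⟩
  simp only [Real.dist_eq]
  exact Finset.sum_sq_le_sq_sum_of_nonneg fun i _ => abs_nonneg _

theorem abs_sub_le_dist (x y : EuclideanSpace ℝ ι) (i : ι) : |x i - y i| ≤ dist x y := by
  rw [dist_eq_norm]
  simpa using PiLp.norm_apply_le (x - y) i

theorem lipschitzWith_coord (S : Set (EuclideanSpace ℝ ι)) (i : ι) :
    LipschitzWith 1 (fun x : S => x.1 i) :=
  LipschitzWith.of_dist_le_mul fun x y => by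
    rw [Real.dist_eq, NNReal.coe_one, one_mul]
    exact abs_sub_le_dist _ _ i

theorem partialSups_lipschitzWith {M : Type*} [MetricSpace M] {c : ℕ → M → ℝ} {K : ℝ≥0}
    (hc : ∀ n, LipschitzWith K (c n)) (n : ℕ) : LipschitzWith K (partialSups c n) := by
  induction n with
  | zero => simpa using hc 0
  | succ n ih =>
    rw [← Order.succ_eq_add_one, partialSups_succ]
    have := ih.max (hc (n + 1))
    rwa [max_self] at this

/-- If all coordinates have singular distribution, there are no nonzero metric derivations. -/
theorem vectorFields_eq_zero_of_mutuallySingular {S : Set (EuclideanSpace ℝ ι)}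
    (hS : Bornology.IsBounded S) (μ : Measure S) [IsFiniteMeasure μ]
    (hμ : ∀ i, μ.map (fun x : S => x.1 i) ⟂ₘ volume) : vectorFields μ = {0} := by
  refine Subset.antisymm (fun δ hδ => ?_) ?_
  swap
  · rintro _ rfl
    refine ⟨⟨0, by simp⟩, ?_, fun f g => ?_⟩
    · exact @continuous_const _ _ (lipWeakStar μ) (linftyWeakStar μ) 0
    · simp
  replace hδ : IsMetricDerivation μ δ := hδ
  obtain ⟨R, hR⟩ := hS.exists_norm_le
  have hR0 : 0 ≤ R ∨ IsEmpty S := by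
    rcases isEmpty_or_nonempty S with h | ⟨⟨x⟩⟩
    · exact Or.inr h
    · exact Or.inl ((norm_nonneg _).trans (hR x.1 x.2))
  rcases isEmpty_or_nonempty S with hE | hne
  · exact LinearMap.ext fun f => Lp.ext (Eventually.of_forall fun x => isEmptyElim x)
  lift R to ℝ≥0 using hR0.resolve_right (not_isEmpty_of_nonempty S)
  have hcoord : ∀ i, Annihilates δ (fun x : S => x.1 i) := by
    intro i
    have hb : IsBddLipschitz 1 R (fun x : S => x.1 i) :=
      ⟨lipschitzWith_coord S i, fun x => (PiLp.norm_apply_le x.1 i).trans (hR x.1 x.2)⟩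
    obtain ⟨f, hf⟩ := hb.exists_lip (μ := μ)
    exact ⟨f, hf, hδ.eq_zero_of_mutuallySingular hb hf (hμ i)⟩
  refine LinearMap.ext fun f => ?_
  obtain ⟨K, C, F, hF, hf⟩ := exists_isBddLipschitz f
  set p := TopologicalSpace.denseSeq S
  -- Cones for the `ℓ¹` distance rather than the Euclidean one: they are built from coordinates by
  -- lattice operations, and still lie below `F` since the `ℓ¹` distance is the larger.
  set c : ℕ → S → ℝ := fun n x => F (p n) - K * ∑ i, |x.1 i - (p n).1 i| with hc
  have hcA : ∀ n, Annihilates δ (c n) := fun n =>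
    (Annihilates.const hδ _).sub ((Annihilates.sum hδ _ fun i _ =>
      ((hcoord i).sub (Annihilates.const hδ _)).abs hδ).const_mul _)
  set G : ℕ → S → ℝ := fun n => partialSups c n with hG
  have hGA : ∀ n, Annihilates δ (G n) := by
    intro n
    induction n with
    | zero => simpa [hG] using hcA 0
    | succ n ih =>
      simp only [hG]
      rw [← Order.succ_eq_add_one, partialSups_succ]
      exact ih.sup hδ (hcA (n + 1))
  choose g hg hg0 using hGA
  set N : ℝ≥0 := (Fintype.card ι : ℝ≥0) with hN
  -- The cones only need `K * N`; the added `K` makes the same constant serve for the limit `F`.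
  have hcL : ∀ n, LipschitzWith (K * N + K) (c n) := by
    intro n
    refine LipschitzWith.of_le_add_mul _ fun x y => ?_
    have h1 : ∑ i, |y.1 i - (p n).1 i| ≤ ∑ i, |x.1 i - (p n).1 i| + N * dist x y := by
      have h2 : (N : ℝ) * dist x y = ∑ i : ι, dist x y := by simp [hN]
      rw [h2, ← Finset.sum_add_distrib]
      refine Finset.sum_le_sum fun i _ => ?_
      have h3 := abs_sub_le (y.1 i) (x.1 i) ((p n).1 i)
      have h4 := abs_sub_le_dist x.1 y.1 i
      rw [abs_sub_comm] at h4
      have h5 : dist x y = dist x.1 y.1 := rfl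
      linarith
    have h6 := mul_le_mul_of_nonneg_left h1 K.coe_nonneg
    have h7 : 0 ≤ (K : ℝ) * dist x y := by positivity
    simp only [hc]
    push_cast
    nlinarith
  have hcF : ∀ n, c n ≤ F := by
    intro n x
    have h1 := hF.lipschitz.le_add_mul (p n) x
    have h2 : (K : ℝ) * dist (p n) x ≤ K * ∑ i, |x.1 i - (p n).1 i| := by
      rw [dist_comm]
      gcongr
      exact dist_le_sum_abs _ _
    simp only [hc]
    linarith
  have hGF : ∀ n, G n ≤ F := fun n => partialSups_le _ _ _ fun k _ => hcF k
  have hcG : ∀ {k n}, k ≤ n → c k ≤ G n := fun h => le_partialSups_of_le c h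
  have hbd : ∀ {H : S → ℝ}, LipschitzWith (K * N + K) H → c 0 ≤ H → H ≤ F →
      IsBddLipschitz (K * N + K) (C + K * (N * (2 * R))) H := by
    refine fun hL h0 h1 => ⟨hL, fun x => abs_le.2 ⟨?_, ?_⟩⟩
    · refine le_trans ?_ (h0 x)
      have h2 : ∑ i, |x.1 i - (p 0).1 i| ≤ N * (2 * R) := by
        have h3 : (N : ℝ) * (2 * R) = ∑ i : ι, (2 * R : ℝ) := by simp [hN]
        rw [h3]
        refine Finset.sum_le_sum fun i _ => (abs_sub_le_dist _ _ i).trans ?_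
        rw [dist_eq_norm]
        refine (norm_sub_le _ _).trans ?_
        linarith [hR x.1 x.2, hR (p 0).1 (p 0).2]
      have h4 := mul_le_mul_of_nonneg_left h2 K.coe_nonneg
      have h5 := (abs_le.1 (hF.bound (p 0))).1
      simp only [hc]
      push_cast
      linarith
    · have h2 := (abs_le.1 (hF.bound x)).2
      have h3 := h1 x
      push_cast
      have : (0 : ℝ) ≤ K * (N * (2 * R)) := by positivity
      linarith
  have hlim : ∀ x, Tendsto (fun n => G n x) atTop (𝓝 (F x)) := by
    intro x
    rw [Metric.tendsto_atTop]
    intro ε hε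
    -- A cone with vertex `p k` loses at most `(K + K * N) * dist x (p k)` at `x`; the `1` keeps the
    -- divisor positive when `K = 0`.
    have hpos : (0 : ℝ) < K + K * N + 1 := by positivity
    obtain ⟨k, hk⟩ := (TopologicalSpace.denseRange_denseSeq S).exists_dist_lt x
      (div_pos hε hpos)
    refine ⟨k, fun n hn => ?_⟩
    have h1 := hcG hn x
    have h2 := hGF n x
    have h3 := hF.lipschitz.le_add_mul x (p k)
    have h4 : ∑ i, |x.1 i - (p k).1 i| ≤ N * dist x (p k) := by
      have h5 : (N : ℝ) * dist x (p k) = ∑ i : ι, dist x (p k) := by simp [hN]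
      rw [h5]
      exact Finset.sum_le_sum fun i _ => abs_sub_le_dist _ _ i
    have h5 := mul_le_mul_of_nonneg_left h4 K.coe_nonneg
    rw [lt_div_iff₀ hpos] at hk
    have h6 : (0 : ℝ) ≤ dist x (p k) := dist_nonneg
    rw [Real.dist_eq, abs_lt]
    simp only [hc] at h1
    constructor <;> nlinarith
  refine Lp.ext ((hδ.ae_eq_of_tendsto (f := g)
    (fun n => hbd (partialSups_lipschitzWith hcL n) (hcG n.zero_le) (hGF n))
    (hbd (hF.lipschitz.weaken (le_add_of_nonneg_left zero_le)) (hcF 0) le_rfl) hg hf hlim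
    (u := fun _ => 0) ?_).trans (Lp.coeFn_zero ℝ ∞ μ).symm)
  simp only [hg0]
  filter_upwards [Lp.coeFn_zero ℝ ∞ μ] with x hx
  simp only [hx, Pi.zero_apply]
  exact tendsto_const_nhds

end Euclidean

end MetricMeasure

/-! ### Triadic column masses and singularity to Lebesgue measure. -/

namespace SierpinskiCarpet

/-- The number of the eight first-level squares that lie in the `r`-th column. -/
def columnCount (r : ℕ) : ℕ := if r = 1 then 2 else 3

/-- The mass of the `j`-th triadic column of generation `n`. -/
def columnMass : ℕ → ℕ → ℝ≥0
  | 0, _ => 1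
  | n + 1, j => columnCount (j / 3 ^ n) / 8 * columnMass n (j % 3 ^ n)

theorem columnMass_succ (n r : ℕ) {j : ℕ} (hj : j < 3 ^ n) :
    columnMass (n + 1) (3 ^ n * r + j) = columnCount r / 8 * columnMass n j := by
  rw [columnMass, Nat.mul_add_div (by positivity), Nat.div_eq_of_lt hj, Nat.mul_add_mod,
    Nat.mod_eq_of_lt hj, add_zero]

/-- The Hellinger affinity of the column masses and the column widths decays exponentially. -/
theorem sum_sqrt_columnMass_le (n : ℕ) :
    ∑ j ∈ Finset.range (3 ^ n), √(columnMass n j * (1 / 3 ^ n)) ≤ (997 / 1000 : ℝ) ^ n := by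
  induction n with
  | zero => simp [columnMass]
  | succ n ih =>
    have hr : ∀ r : ℕ, ∑ j ∈ Finset.range (3 ^ n),
        √(columnMass (n + 1) (3 ^ n * r + j) * (1 / 3 ^ (n + 1)))
        = √(columnCount r / 24) * ∑ j ∈ Finset.range (3 ^ n), √(columnMass n j * (1 / 3 ^ n)) := by
      intro r
      rw [Finset.mul_sum]
      refine Finset.sum_congr rfl fun j hj => ?_
      rw [columnMass_succ n r (Finset.mem_range.1 hj), ← Real.sqrt_mul (by positivity)]
      congr 1
      push_cast
      rw [pow_succ]
      field_simp
      ring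
    have h3 : 3 ^ (n + 1) = 3 ^ n + 3 ^ n + 3 ^ n := by ring
    have h0 := hr 0
    have h1 := hr 1
    have h2 := hr 2
    rw [mul_zero] at h0
    simp only [zero_add] at h0
    rw [mul_one] at h1
    rw [mul_two] at h2
    rw [h3, Finset.sum_range_add, Finset.sum_range_add, h0, h1, h2]
    -- Here `24 = 8 * 3`, mass weight times width weight. The rounded values of `√(1/8)`, `√(1/12)`,
    -- `√(1/8)` add up to `997/1000`, still below `1`.
    have e1 : √((columnCount 0 : ℝ) / 24) ≤ 354 / 1000 := by
      rw [Real.sqrt_le_left (by norm_num)]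
      norm_num [columnCount]
    have e2 : √((columnCount 1 : ℝ) / 24) ≤ 289 / 1000 := by
      rw [Real.sqrt_le_left (by norm_num)]
      norm_num [columnCount]
    have e3 : √((columnCount 2 : ℝ) / 24) ≤ 354 / 1000 := by
      rw [Real.sqrt_le_left (by norm_num)]
      norm_num [columnCount]
    rw [← add_mul, ← add_mul, pow_succ, mul_comm _ (997 / 1000 : ℝ)]
    exact mul_le_mul (by linarith) ih (Finset.sum_nonneg fun _ _ => Real.sqrt_nonneg _)
      (by norm_num)

/-- The `j`-th closed triadic interval of generation `n`. -/
def triadicIcc (n j : ℕ) : Set ℝ := Icc (j / 3 ^ n) ((j + 1) / 3 ^ n)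

theorem exists_mem_triadicIcc (n : ℕ) {x : ℝ} (hx : x ∈ Icc (0 : ℝ) 1) :
    ∃ j < 3 ^ n, x ∈ triadicIcc n j := by
  have hp : (0 : ℝ) < 3 ^ n := by positivity
  rcases hx.2.lt_or_eq with h | h
  · refine ⟨⌊x * 3 ^ n⌋₊, ?_, ?_, ?_⟩
    · rw [Nat.floor_lt (mul_nonneg hx.1 hp.le)]
      push_cast
      nlinarith
    · rw [div_le_iff₀ hp]
      exact Nat.floor_le (mul_nonneg hx.1 hp.le)
    · rw [le_div_iff₀ hp]
      exact (Nat.lt_floor_add_one _).le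
  · refine ⟨3 ^ n - 1, Nat.sub_lt (by positivity) one_pos, ?_⟩
    rw [triadicIcc, Nat.cast_sub (Nat.one_le_pow _ _ (by norm_num)), h]
    push_cast
    constructor
    · rw [div_le_one hp]; linarith
    · rw [le_div_iff₀ hp]; linarith

/-- The intervals are split by whether mass or width is larger. The smaller of the two is at most
their geometric mean, so the affinity bounds both the length of the heavy intervals and the mass of
the light ones. Both bounds are summable, and Borel–Cantelli applies on each side. -/
theorem mutuallySingular_of_le_columnMass {ν : Measure ℝ} (h0 : ν (Icc 0 1)ᶜ = 0)
    (h : ∀ n, ∀ j < 3 ^ n, ν (triadicIcc n j) ≤ columnMass n j) : ν ⟂ₘ volume := by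
  classical
  set T : ℕ → Finset ℕ := fun n =>
    (Finset.range (3 ^ n)).filter fun j => (1 / 3 ^ n : ℝ) ≤ columnMass n j with hT
  set E : ℕ → Set ℝ := fun n => ⋃ j ∈ T n, triadicIcc n j with hE
  have hsum : ∀ n (A : Finset ℕ) (a : ℕ → ℝ), A ⊆ Finset.range (3 ^ n) → (∀ j, 0 ≤ a j) →
      (∀ j ∈ A, a j * a j ≤ columnMass n j * (1 / 3 ^ n)) →
      ∑ j ∈ A, ENNReal.ofReal (a j) ≤ ENNReal.ofReal ((997 / 1000 : ℝ) ^ n) := by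
    intro n A a hA ha haj
    rw [← ENNReal.ofReal_sum_of_nonneg fun j _ => ha j]
    refine ENNReal.ofReal_le_ofReal (le_trans ?_ (sum_sqrt_columnMass_le n))
    refine (Finset.sum_le_sum fun j hj => Real.le_sqrt_of_sq_le ?_).trans
      (Finset.sum_le_sum_of_subset_of_nonneg hA fun _ _ _ => Real.sqrt_nonneg _)
    rw [pow_two]
    exact haj j hj
  have hvol : ∀ n, volume (E n) ≤ ENNReal.ofReal ((997 / 1000 : ℝ) ^ n) := by
    intro n
    refine (measure_biUnion_finset_le _ _).trans (le_trans (Finset.sum_le_sum fun j _ => ?_)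
      (hsum n (T n) (fun _ => 1 / 3 ^ n) (Finset.filter_subset _ _) (fun _ => by positivity)
        fun j hj => ?_))
    · rw [triadicIcc, Real.volume_Icc]
      apply ENNReal.ofReal_le_ofReal
      rw [← sub_div, add_sub_cancel_left]
    · exact mul_le_mul_of_nonneg_right (Finset.mem_filter.1 hj).2 (by positivity)
  have hν : ∀ n, ν (E n)ᶜ ≤ ENNReal.ofReal ((997 / 1000 : ℝ) ^ n) := by
    intro n
    have hsub : (E n)ᶜ ⊆ (Icc 0 1)ᶜ ∪ ⋃ j ∈ Finset.range (3 ^ n) \ T n, triadicIcc n j := by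
      intro x hx
      by_cases hx1 : x ∈ Icc (0 : ℝ) 1
      · right
        obtain ⟨j, hj, hxj⟩ := exists_mem_triadicIcc n hx1
        refine mem_biUnion (x := j) ?_ hxj
        rw [Finset.mem_coe, Finset.mem_sdiff]
        exact ⟨Finset.mem_range.2 hj, fun hjT => hx (mem_biUnion (x := j) hjT hxj)⟩
      · exact Or.inl hx1
    refine (measure_mono hsub).trans ((measure_union_le _ _).trans ?_)
    rw [h0, zero_add]
    refine (measure_biUnion_finset_le _ _).trans (le_trans (Finset.sum_le_sum fun j hj => ?_)
      (hsum n (Finset.range (3 ^ n) \ T n) (fun j => columnMass n j) Finset.sdiff_subset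
        (fun _ => NNReal.coe_nonneg _) fun j hj => ?_))
    · rw [ENNReal.ofReal_coe_nnreal]
      exact h n j (Finset.mem_range.1 (Finset.mem_sdiff.1 hj).1)
    · refine mul_le_mul_of_nonneg_left ?_ (NNReal.coe_nonneg _)
      have h1 := Finset.mem_sdiff.1 hj
      by_contra hcon
      exact h1.2 (Finset.mem_filter.2 ⟨h1.1, (not_le.1 hcon).le⟩)
  have hfin : ∑' n : ℕ, ENNReal.ofReal ((997 / 1000 : ℝ) ^ n) ≠ ∞ :=
    (summable_geometric_of_lt_one (by norm_num) (by norm_num)).tsum_ofReal_ne_top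
  have hEm : ∀ n, MeasurableSet (E n) := fun n =>
    (T n).measurableSet_biUnion fun _ _ => measurableSet_Icc
  -- A point outside `limsup E` is eventually, hence infinitely often, in `(E n)ᶜ`, so this set is
  -- `ν`-null by Borel–Cantelli for the complements.
  refine ⟨(limsup E atTop)ᶜ, (MeasurableSet.measurableSet_limsup hEm).compl, ?_, ?_⟩
  · refine measure_mono_null ?_ (measure_limsup_atTop_eq_zero (μ := ν) (s := fun n => (E n)ᶜ)
      (ne_top_of_le_ne_top hfin (ENNReal.tsum_le_tsum hν)))
    intro x hx
    rw [mem_compl_iff, mem_limsup_iff_frequently_mem, not_frequently] at hx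
    exact mem_limsup_iff_frequently_mem.2 hx.frequently
  · rw [compl_compl]
    exact measure_limsup_atTop_eq_zero
      (ne_top_of_le_ne_top hfin (ENNReal.tsum_le_tsum hvol))

/-! ### Self-similarity of the carpet. -/

/-- Indexing generations from `0` removes the truncated subtraction, and indexing holes by `Fin 2 →
ℕ` treats the two axes alike. -/
theorem mem_iff (x : EuclideanSpace ℝ (Fin 2)) : x ∈ sierpinskiCarpet ↔
    (∀ i, x i ∈ Icc (0 : ℝ) 1) ∧ ∀ (n : ℕ) (k : Fin 2 → ℕ), (∀ i, 1 ≤ k i ∧ k i ≤ 3 ^ n) →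
      ∃ i, x i ∉ Ioo ((3 * k i - 2 : ℝ) / 3 ^ (n + 1)) ((3 * k i - 1 : ℝ) / 3 ^ (n + 1)) := by
  refine and_congr_right fun _ => ⟨fun h n k hk => ?_, ?_⟩
  · by_contra! hcon
    exact h ⟨n + 1, k 0, k 1, by omega, by simpa using hk 0, by simpa using hk 1, hcon 0, hcon 1⟩
  · rintro h ⟨n, k, l, hn, hk, hl, h0, h1⟩
    obtain ⟨n, rfl⟩ := Nat.exists_eq_add_of_le' hn
    obtain ⟨i, hi⟩ := h n ![k, l] (by
      intro i
      fin_cases i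
      · simpa using hk
      · simpa using hl)
    fin_cases i
    · exact hi h0
    · exact hi h1

/-- The similarity of ratio `1/3` onto the square with lower left corner `r / 3`. -/
def contraction (r : Fin 2 → ℕ) (y : EuclideanSpace ℝ (Fin 2)) : EuclideanSpace ℝ (Fin 2) :=
  (3⁻¹ : ℝ) • (y + WithLp.toLp 2 fun i => (r i : ℝ))

theorem lipschitzWith_contraction (r : Fin 2 → ℕ) : LipschitzWith 3⁻¹ (contraction r) :=
  LipschitzWith.of_dist_le_mul fun x y => by
    simp [contraction, dist_smul₀]

theorem expand_mem {x : EuclideanSpace ℝ (Fin 2)} (hx : x ∈ sierpinskiCarpet) {r : Fin 2 → ℕ}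
    (hr : ∀ i, r i ≤ 2 ∧ x i ∈ triadicIcc 1 (r i)) :
    (3 : ℝ) • x - WithLp.toLp 2 (fun i => (r i : ℝ)) ∈ sierpinskiCarpet := by
  rw [mem_iff] at hx ⊢
  have hy : ∀ i, ((3 : ℝ) • x - WithLp.toLp 2 (fun i => (r i : ℝ))) i = 3 * x i - r i := by
    intro i
    simp
  refine ⟨fun i => ?_, fun n k hk => ?_⟩
  · obtain ⟨h1, h2⟩ := (hr i).2
    rw [hy]
    constructor <;> linarith
  -- Shrinking hole `k` by `1/3` into square `r` gives the hole of the next generation with this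
  -- index.
  · obtain ⟨i, hi⟩ := hx.2 (n + 1) (fun i => k i + r i * 3 ^ n) (fun i => ⟨by
      have := (hk i).1
      omega, by
      have h1 := (hk i).2
      have h2 := Nat.mul_le_mul_right (3 ^ n) (hr i).1
      rw [pow_succ]
      omega⟩)
    refine ⟨i, fun hcon => hi ?_⟩
    rw [hy] at hcon
    obtain ⟨h1, h2⟩ := hcon
    rw [div_lt_iff₀ (by positivity)] at h1
    rw [lt_div_iff₀ (by positivity)] at h2
    constructor
    · rw [div_lt_iff₀ (by positivity), pow_succ _ (n + 1)]
      push_cast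
      rw [pow_succ] at h1 ⊢
      nlinarith
    · rw [lt_div_iff₀ (by positivity), pow_succ _ (n + 1)]
      push_cast
      rw [pow_succ] at h2 ⊢
      nlinarith

/-- The part of the carpet over a triadic interval of the `i`-th axis. -/
def column (i : Fin 2) (n j : ℕ) : Set (EuclideanSpace ℝ (Fin 2)) :=
  {x | x ∈ sierpinskiCarpet ∧ x i ∈ triadicIcc n j}

/-- The rows of the first-level squares in the `r`-th column. -/
def columnRows (r : ℕ) : Finset ℕ := if r = 1 then {0, 2} else {0, 1, 2}

theorem card_columnRows (r : ℕ) : (columnRows r).card = columnCount r := by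
  unfold columnRows columnCount
  split_ifs <;> rfl

/-- A point of the column lies in a first-level square, and blowing that square up by `3` lands in
the carpet. In the middle column the central square must be avoided; as the removed square is open,
this works only off the two lines bounding that column. -/
theorem column_succ_subset (i : Fin 2) (n : ℕ) {r j : ℕ} (hr : r < 3) (hj : j < 3 ^ n) :
    column i (n + 1) (3 ^ n * r + j) ⊆
      (⋃ l ∈ columnRows r, contraction (fun k => if k = i then r else l) '' column i n j) ∪
        ({x | x i = 1 / 3} ∪ {x | x i = 2 / 3}) := by
  rintro x ⟨hx, hxi⟩
  by_cases hline : x i = 1 / 3 ∨ x i = 2 / 3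
  · exact Or.inr hline
  left
  push Not at hline
  obtain ⟨k, hk⟩ : ∃ k : Fin 2, k ≠ i := exists_ne i
  have hki : ∀ a : Fin 2, a ≠ i → a = k := by intro a; omega
  have hp : (0 : ℝ) < 3 ^ n := by positivity
  have hj' : (j : ℝ) + 1 ≤ 3 ^ n := by exact_mod_cast hj
  have hyi : 3 * x i - r ∈ triadicIcc n j := by
    obtain ⟨h1, h2⟩ := hxi
    rw [div_le_iff₀ (by positivity)] at h1
    rw [le_div_iff₀ (by positivity)] at h2
    push_cast at h1 h2
    rw [pow_succ] at h1 h2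
    constructor
    · rw [div_le_iff₀ hp]; nlinarith
    · rw [le_div_iff₀ hp]; nlinarith
  have hxr : x i ∈ triadicIcc 1 r := by
    obtain ⟨h1, h2⟩ := hyi
    have h3 : (0 : ℝ) ≤ j / 3 ^ n := by positivity
    have h4 : ((j : ℝ) + 1) / 3 ^ n ≤ 1 := by rwa [div_le_one hp]
    constructor <;> linarith
  have hrow : ∃ l ∈ columnRows r, x k ∈ triadicIcc 1 l := by
    obtain ⟨l, hl, hxl⟩ := exists_mem_triadicIcc 1 (hx.1 k)
    by_cases hmem : l ∈ columnRows r
    · exact ⟨l, hmem, hxl⟩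
    have hrl : r = 1 ∧ l = 1 := by
      unfold columnRows at hmem
      split_ifs at hmem with h1
      · simp at hmem
        omega
      · simp at hmem
        omega
    obtain ⟨rfl, rfl⟩ := hrl
    -- The central hole. Strict inclusion of `x i` in `(1/3, 2/3)` forces the other coordinate out
    -- of the open middle third, hence into row `0` or `2`.
    obtain ⟨a, ha⟩ := ((mem_iff x).1 hx).2 0 (fun _ => 1) (by simp)
    have hai : a ≠ i := by
      rintro rfl
      refine ha ⟨?_, ?_⟩
      · refine lt_of_le_of_ne ?_ (Ne.symm ?_)
        · have := hxr.1
          norm_num at this ⊢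
          linarith
        · have := hline.1
          norm_num at this ⊢
          exact this
      · refine lt_of_le_of_ne ?_ ?_
        · have := hxr.2
          norm_num at this ⊢
          linarith
        · have := hline.2
          norm_num at this ⊢
          exact this
    rw [hki a hai] at ha
    norm_num at ha
    by_cases h13 : 1 / 3 < x k
    · refine ⟨2, by simp [columnRows], ?_⟩
      have h23 := ha (by linarith)
      have := (hx.1 k).2
      constructor <;> norm_num <;> linarith
    · refine ⟨0, by simp [columnRows], ?_⟩
      have := (hx.1 k).1
      constructor <;> norm_num <;> linarith
  obtain ⟨l, hl, hxl⟩ := hrow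
  have hl2 : l ≤ 2 := by
    unfold columnRows at hl
    split_ifs at hl <;> simp at hl <;> omega
  refine mem_biUnion (x := l) hl ⟨(3 : ℝ) • x -
    WithLp.toLp 2 (fun a => ((if a = i then r else l : ℕ) : ℝ)), ⟨expand_mem hx ?_, ?_⟩, ?_⟩
  · intro a
    by_cases ha : a = i
    · subst ha
      simp only [if_true]
      exact ⟨by omega, hxr⟩
    · rw [if_neg ha, hki a ha]
      exact ⟨hl2, hxl⟩
  · simpa using hyi
  · simp [contraction]

/-! ### Hausdorff measure of the columns. -/

theorem one_lt_dim : 1 < Real.log 8 / Real.log 3 := by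
  rw [one_lt_div (Real.log_pos (by norm_num))]
  exact Real.log_lt_log (by norm_num) (by norm_num)

theorem hausdorffMeasure_line (i : Fin 2) (c : ℝ) :
    Measure.hausdorffMeasure (Real.log 8 / Real.log 3)
      {x : EuclideanSpace ℝ (Fin 2) | x i = c} = 0 := by
  set g : ℝ → EuclideanSpace ℝ (Fin 2) := fun t => WithLp.toLp 2 fun k => if k = i then c else t
  have hg : LipschitzWith 2 g := by
    refine LipschitzWith.of_dist_le_mul fun s t => (MetricMeasure.dist_le_sum_abs _ _).trans ?_
    have : ∀ k, |g s k - g t k| ≤ dist s t := by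
      intro k
      by_cases hk : k = i
      · simp [g, hk]
      · simp [g, hk, Real.dist_eq]
    refine (Finset.sum_le_sum fun k _ => this k).trans ?_
    simp
  have hsub : {x : EuclideanSpace ℝ (Fin 2) | x i = c} ⊆ range g := by
    intro x hx
    obtain ⟨k, hk⟩ : ∃ k : Fin 2, k ≠ i := exists_ne i
    have hki : ∀ a : Fin 2, a ≠ i → a = k := by intro a; omega
    refine ⟨x k, ?_⟩
    ext a
    by_cases ha : a = i
    · subst ha
      simpa [g] using hx.symm
    · rw [hki a ha]
      simp [g, hk]
  refine measure_mono_null hsub ?_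
  have hdim : dimH (range g) ≤ 1 := by
    simpa [Real.dimH_univ] using hg.dimH_range_le
  have hd := one_lt_dim
  generalize Real.log 8 / Real.log 3 = d at hd ⊢
  lift d to ℝ≥0 using by linarith
  exact hausdorffMeasure_of_dimH_lt (hdim.trans_lt (by exact_mod_cast hd))

theorem third_rpow_dim :
    ((3⁻¹ : ℝ≥0) : ℝ≥0∞) ^ (Real.log 8 / Real.log 3) = ((8⁻¹ : ℝ≥0) : ℝ≥0∞) := by
  rw [← ENNReal.coe_rpow_of_nonneg _ (by linarith [one_lt_dim])]
  congr 1
  rw [NNReal.inv_rpow]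
  congr 1
  apply NNReal.coe_injective
  push_cast
  exact Real.rpow_logb (by norm_num) (by norm_num) (by norm_num)

/-- Each contraction scales the measure by at most `3⁻ˢ = 1/8`, and the boundary lines are null
because `s > 1`. Subadditivity is enough, so overlaps of the squares play no role. -/
theorem hausdorffMeasure_column_le (i : Fin 2) (n : ℕ) {j : ℕ} (hj : j < 3 ^ n) :
    Measure.hausdorffMeasure (Real.log 8 / Real.log 3) (column i n j) ≤
      columnMass n j * Measure.hausdorffMeasure (Real.log 8 / Real.log 3) sierpinskiCarpet := by
  induction n generalizing j with
  | zero =>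
    rw [columnMass, ENNReal.coe_one, one_mul]
    exact measure_mono fun x hx => hx.1
  | succ n ih =>
    have hp : 0 < 3 ^ n := by positivity
    obtain ⟨r, j, hr, hj', rfl⟩ : ∃ r j', r < 3 ∧ j' < 3 ^ n ∧ j = 3 ^ n * r + j' :=
      ⟨j / 3 ^ n, j % 3 ^ n, Nat.div_lt_of_lt_mul (by rwa [pow_succ] at hj), Nat.mod_lt _ hp,
        (Nat.div_add_mod _ _).symm⟩
    refine (measure_mono (column_succ_subset i n hr hj')).trans ?_
    refine (measure_union_le _ _).trans ?_
    rw [measure_union_null (hausdorffMeasure_line i _) (hausdorffMeasure_line i _), add_zero]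
    refine (measure_biUnion_finset_le _ _).trans ?_
    refine (Finset.sum_le_card_nsmul _ _ _ fun l _ =>
      ((lipschitzWith_contraction _).hausdorffMeasure_image_le (by linarith [one_lt_dim]) _).trans
        (mul_le_mul_right (ih hj') _)).trans ?_
    rw [third_rpow_dim, card_columnRows, columnMass_succ n r hj', nsmul_eq_mul]
    have h8 : (((columnCount r : ℝ≥0) / 8 : ℝ≥0) : ℝ≥0∞)
        = (columnCount r : ℝ≥0∞) * ((8⁻¹ : ℝ≥0) : ℝ≥0∞) := by
      rw [div_eq_mul_inv, ENNReal.coe_mul, ENNReal.coe_natCast]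
    rw [ENNReal.coe_mul, h8]
    simp only [mul_assoc, le_refl]

theorem carpetMeasure_apply (A : Set sierpinskiCarpet) : carpetMeasure A =
    (Measure.hausdorffMeasure (Real.log 8 / Real.log 3) sierpinskiCarpet)⁻¹ *
      Measure.hausdorffMeasure (Real.log 8 / Real.log 3)
        ((fun x : sierpinskiCarpet => x.1) '' A) := by
  have h : ∀ B : Set sierpinskiCarpet,
      Measure.hausdorffMeasure (Real.log 8 / Real.log 3) ((fun x : sierpinskiCarpet => x.1) '' B)
        = Measure.hausdorffMeasure (Real.log 8 / Real.log 3) B := fun B =>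
    isometry_subtype_coe.hausdorffMeasure_image (Or.inl (by linarith [one_lt_dim])) B
  have huniv : (fun x : sierpinskiCarpet => x.1) '' univ = sierpinskiCarpet := by
    rw [image_univ]
    exact Subtype.range_coe
  rw [h, carpetMeasure, Measure.smul_apply, smul_eq_mul, ← h univ, huniv]

instance : IsFiniteMeasure carpetMeasure := by
  refine ⟨lt_of_le_of_lt ?_ ENNReal.one_lt_top⟩
  rw [carpetMeasure_apply, image_univ, show range (fun x : sierpinskiCarpet => x.1) =
    sierpinskiCarpet from Subtype.range_coe]
  -- True in `ℝ≥0∞` for every value, including `0` and `∞`, so positivity and finiteness of the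
  -- Hausdorff measure of the carpet are not needed.
  exact ENNReal.inv_mul_le_one _

theorem mutuallySingular_map_coord (i : Fin 2) :
    carpetMeasure.map (fun x : sierpinskiCarpet => x.1 i) ⟂ₘ volume := by
  have hm : Measurable fun x : sierpinskiCarpet => x.1 i :=
    (MetricMeasure.lipschitzWith_coord sierpinskiCarpet i).continuous.measurable
  refine mutuallySingular_of_le_columnMass ?_ fun n j hj => ?_
  · rw [Measure.map_apply hm measurableSet_Icc.compl]
    convert measure_empty (μ := carpetMeasure)
    ext x
    simpa using x.2.1 i
  · rw [triadicIcc, Measure.map_apply hm measurableSet_Icc, carpetMeasure_apply]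
    refine (mul_le_mul_right (measure_mono (t := column i n j) ?_) _).trans ?_
    · rintro _ ⟨x, hx, rfl⟩
      exact ⟨x.2, hx⟩
    · refine (mul_le_mul_right (hausdorffMeasure_column_le i n hj) _).trans ?_
      rw [mul_left_comm]
      exact mul_le_of_le_one_right' (ENNReal.inv_mul_le_one _)

theorem isBounded : Bornology.IsBounded sierpinskiCarpet := by
  refine (Metric.isBounded_iff_subset_closedBall 0).2 ⟨2, fun x hx => ?_⟩
  rw [Metric.mem_closedBall]
  refine (MetricMeasure.dist_le_sum_abs _ _).trans ?_
  rw [Fin.sum_univ_two]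
  have h0 := hx.1 0
  have h1 := hx.1 1
  simp only [PiLp.zero_apply, sub_zero]
  rw [abs_of_nonneg h0.1, abs_of_nonneg h1.1]
  linarith [h0.2, h1.2]

end SierpinskiCarpet

end

theorem theorem40 : MetricMeasure.vectorFields carpetMeasure = {0} :=
  MetricMeasure.vectorFields_eq_zero_of_mutuallySingular SierpinskiCarpet.isBounded _
    SierpinskiCarpet.mutuallySingular_map_coord
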